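/- For each $N\ge 1$ consider a network of $N$ lines with i.i.d. surplus capacities $C^N(1),\dots,C^N(N)$ with common distribution function $F$, and order statistics $C^N_{(1)}\le\dots\le C^N_{(N)}$. Let $l^N(\cdot)$ be the (deterministic, nondecreasing) load surge function, and let the number of failed lines be $$A^N=\max\{m\in\{0,\dots,N\}: C^N_{(i)}\le l^N(i)\text{ for all } 1\le i\le m\}.$$ Let $k=k(N)$ be real thresholds, $0<k\le N$, with $k\to\infty$ and $N-k\to\infty$ as $N\to\infty$. Suppose that, for some real constant $\theta$, integers $M\ge 1$ and $N_0$, and perturbations $\Delta(i,N)$, $$F(l^N(i))=\frac{\theta+i-1+\Delta(i,N)}{N}\qquad(1\le i\le \lceil k(N)\rceil,\ N\ge N_0),$$ that $\Delta(i,N)\to\Delta(i)$ as $N\to\infty$ for every fixed $i\ge1$, and that $\Delta(i,N)=0$ for all $N\ge N_0$ and $M\le i\le\lceil k(N)\rceil$. Put $c_i=\theta+i-1+\Delta(i)$ for $i\ge 1$, $\beta_0=1$, $\beta_i=\sum_{j=1}^{i}\frac{(-1)^{j+1}}{j!}\,\beta_{i-j}\,(c_{i-j+1})^{j}$ for $i\ge1$,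 and $\gamma(s,x)=\int_0^x t^{s-1}e^{-t}\,dt$. Then $$\lim_{N\to\infty}\sqrt{\frac{kN}{N-k}}\;\mathbb{P}(A^N\ge k)=V_M(\theta,\Delta),$$ where $$V_M(\theta,\Delta)=\frac{2}{\sqrt{2\pi}}\Bigl(\frac{\theta}{(M-1)!}\gamma(M,c_M)+\frac{(c_M)^M}{(M-1)!}e^{-c_M}+\sum_{j=1}^{M-1}\beta_{j-1}e^{-c_j}\frac{\Delta(j)}{(M-j)!}\gamma(M-j+1,c_M-c_j)-\sum_{j=1}^{M-1}\beta_{j-1}\frac{(c_M-c_j)^{M-j+1}}{(M-j)!}e^{-c_M}\Bigr).$$ Moreover, if $c_1>0$, then $V_M(\theta,\Delta)\in(0,\infty)$. -/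

import Mathlib

open MeasureTheory ProbabilityTheory Filter Topology

noncomputable section

/-- The order statistic `x_(i+1)` of a sample `x` of size `N` (the index `i : Fin N` starts at `0`),
that is, the entry in position `i` after sorting the sample in nondecreasing order. -/
def orderStat {N : ℕ} (x : Fin N → ℝ) (i : Fin N) : ℝ := x (Tuple.sort x i)

/-- The number of failed lines in a network of `N` lines with surplus capacities `x` and load surge
function `l`: the largest `m ≤ N` with `x_(i) ≤ l i` for all `i = 1, …, m`
(it is `0` if `l 1 < x_(1)`). -/
def failedLines {N : ℕ} (l : ℕ → ℝ) (x : Fin N → ℝ) : ℕ :=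
  sSup {m : ℕ | m ≤ N ∧ ∀ i : Fin N, (i : ℕ) < m → orderStat x i ≤ l (i + 1)}

/-- The limiting levels `c_i = θ + i - 1 + Δ(i)`, for `i ≥ 1`. -/
def level (θ : ℝ) (Δ : ℕ → ℝ) (i : ℕ) : ℝ := θ + i - 1 + Δ i

/-- The coefficients `β_0 = 1` and
`β_i = ∑_{j=1}^{i} (-1)^(j+1) / j! * β_(i-j) * (c_(i-j+1))^j` for `i ≥ 1`
(below, `i = n + 1`, and the summation index is `j + 1`). -/
def betaCoeff (c : ℕ → ℝ) : ℕ → ℝ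
  | 0 => 1
  | n + 1 => ∑ j : Fin (n + 1), (-1 : ℝ) ^ ((j : ℕ) + 1 + 1) / (Nat.factorial ((j : ℕ) + 1) : ℝ)
      * betaCoeff c (n - j) * c (n - j + 1) ^ ((j : ℕ) + 1)

/-- The lower incomplete gamma function `γ(s, x) = ∫_0^x t^(s-1) e^(-t) dt`. -/
def lowerGamma (s x : ℝ) : ℝ := ∫ t in (0 : ℝ)..x, t ^ (s - 1) * Real.exp (-t)

/-- The constant `V_M(θ, Δ)`, for `M ≥ 1`. -/
def truncConst (M : ℕ) (θ : ℝ) (Δ : ℕ → ℝ) : ℝ :=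
  let c := level θ Δ
  let β := betaCoeff c
  2 / Real.sqrt (2 * Real.pi) *
    (θ / (Nat.factorial (M - 1) : ℝ) * lowerGamma M (c M)
      + c M ^ M / (Nat.factorial (M - 1) : ℝ) * Real.exp (-c M)
      + ∑ j ∈ Finset.Icc 1 (M - 1), β (j - 1) * Real.exp (-c j)
          * (Δ j / (Nat.factorial (M - j) : ℝ)) * lowerGamma ((M : ℝ) - j + 1) (c M - c j)
      - ∑ j ∈ Finset.Icc 1 (M - 1), β (j - 1)
          * ((c M - c j) ^ (M - j + 1) / (Nat.factorial (M - j) : ℝ)) * Real.exp (-c M))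

end

/-! The coefficients `betaCoeff c` are Gončarov numbers: for all levels `c`, x^n/n! = ∑_j β_j (x -
c_(j+1))^(n-j)/(n-j)! (`sum_betaCoeff_mul_divPow`), and this triangular system determines them.
Splitting according to the first violated constraint, whose two parts involve disjoint sets of
coordinates, shows that the crossing probabilities satisfy the same system at x = 1. Hence P(A ≥ K)
is N!/N^N times the part j ≥ K of the expansion (`measureReal_le_failedLines`), for any continuation
of the levels beyond K. The continuation chosen is θ + i - 1.

For such levels, linear beyond M, β_n is a combination of at most M + 1 Abel polynomials
(`betaCoeff_eq_abelCoeff_sub`), and Stirling's formula gives β_n ~ G e^(θ+n) / (√(2π) n^(3/2)), with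
G = `goncarovLimit`. With j = N - m, the j-th term of the tail is then asymptotic to G/√(2π) · √N /
(j^(3/2) √m), uniformly as j and m grow. This is V = 2G/√(2π) times the increment in m of
√(m/((N-m)N)), so the tail telescopes (`tendsto_sum_div_of_increments`).

It remains to see that V is `truncConst`: incomplete gamma functions at integers are partial
exponential sums, and all multiples of e^(-c_M) cancel by the expansion (`truncConst_eq`). If c_1 >
0, then G > 0 because β_n dominates a positive multiple of an Abel polynomial with positive
parameter (`goncarovLimit_pos`). -/

open Finset.HasAntidiagonal (antidiagonal mem_antidiagonal)

/-! ### Divided powers and convolutions -/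

/-- The divided power `x ^ n / n!`. -/
noncomputable def divPow (x : ℝ) (n : ℕ) : ℝ := x ^ n / (n.factorial : ℝ)

@[simp] lemma divPow_zero (x : ℝ) : divPow x 0 = 1 := by simp [divPow]

lemma divPow_zero_left (n : ℕ) : divPow 0 n = if n = 0 then 1 else 0 := by
  rcases n with _ | n <;> simp [divPow]

lemma divPow_nonneg {x : ℝ} (hx : 0 ≤ x) (n : ℕ) : 0 ≤ divPow x n := by
  unfold divPow; positivity

lemma divPow_add (x y : ℝ) (n : ℕ) :
    divPow (x + y) n = ∑ p ∈ antidiagonal n, divPow x p.1 * divPow y p.2 := by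
  unfold divPow
  rw [(Commute.all x y).add_pow', Finset.sum_div]
  refine Finset.sum_congr rfl fun p hp => ?_
  obtain rfl := mem_antidiagonal.1 hp
  have h := Nat.add_choose_mul_factorial_mul_factorial p.1 p.2
  have h' : (((p.1 + p.2).choose p.1 : ℕ) : ℝ) * p.1.factorial * p.2.factorial
      = (p.1 + p.2).factorial := by
    rw [Nat.choose_symm_add]; exact_mod_cast h
  rw [nsmul_eq_mul, ← h']
  have h1 : ((p.1 + p.2).choose p.1 : ℝ) ≠ 0 := by
    exact_mod_cast (Nat.choose_pos (Nat.le_add_right _ _)).ne'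
  field_simp

lemma sum_antidiagonal_assoc (f : ℕ → ℕ → ℕ → ℝ) (n : ℕ) :
    ∑ p ∈ antidiagonal n, ∑ q ∈ antidiagonal p.1, f q.1 q.2 p.2 =
      ∑ p ∈ antidiagonal n, ∑ q ∈ antidiagonal p.2, f p.1 q.1 q.2 := by
  simp only [Finset.sum_sigma']
  refine Finset.sum_bij' (fun x _ => ⟨(x.2.1, x.2.2 + x.1.2), (x.2.2, x.1.2)⟩)
    (fun x _ => ⟨(x.1.1 + x.2.1, x.2.2), (x.1.1, x.2.1)⟩) ?_ ?_ ?_ ?_ ?_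
  all_goals
    rintro ⟨⟨a, b⟩, ⟨c, d⟩⟩ h
    simp only [Finset.mem_sigma, mem_antidiagonal, and_true] at h ⊢
  · omega
  · omega
  · obtain ⟨h1, rfl⟩ := h; rfl
  · obtain ⟨h1, rfl⟩ := h; rfl

/-! ### Gončarov numbers and Abel polynomials -/

section Goncarov

variable (c : ℕ → ℝ)

lemma betaCoeff_zero : betaCoeff c 0 = 1 := by rw [betaCoeff]

/-- The recursion for `betaCoeff` with all terms on one side: a convolution identity, the expansion
at 0. -/
lemma sum_betaCoeff_mul_divPow_neg (n : ℕ) :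
    ∑ p ∈ antidiagonal n, betaCoeff c p.1 * divPow (-c (p.1 + 1)) p.2
      = divPow 0 n := by
  rw [Finset.Nat.sum_antidiagonal_eq_sum_range_succ_mk]
  rcases n with _ | n
  · simp [betaCoeff_zero]
  rw [Finset.sum_range_succ]
  rw [show betaCoeff c (n + 1) = _ from betaCoeff.eq_2 c n]
  rw [Fin.sum_univ_eq_sum_range (fun j => (-1 : ℝ) ^ (j + 1 + 1) /
    (Nat.factorial (j + 1) : ℝ) * betaCoeff c (n - j) * c (n - j + 1) ^ (j + 1)) (n + 1),
    ← Finset.sum_range_reflect, divPow_zero_left]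
  simp only [Nat.sub_self, divPow_zero, mul_one, if_neg (Nat.succ_ne_zero n)]
  rw [← Finset.sum_add_distrib]
  refine Finset.sum_eq_zero fun j hj => ?_
  have hj' : j ≤ n := Nat.lt_succ_iff.1 (Finset.mem_range.1 hj)
  have e1 : n + 1 - 1 - j = n - j := by omega
  have e2 : n + 1 - (n - j) = j + 1 := by omega
  simp only [e1, e2, divPow]
  rw [neg_pow, pow_succ (-1 : ℝ) (j + 1)]
  ring

/-- The Abel–Gončarov expansion of the divided powers. -/
lemma sum_betaCoeff_mul_divPow (x : ℝ) (n : ℕ) :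
    ∑ p ∈ antidiagonal n, betaCoeff c p.1 * divPow (x - c (p.1 + 1)) p.2
      = divPow x n := by
  have h : ∀ p : ℕ × ℕ, betaCoeff c p.1 * divPow (x - c (p.1 + 1)) p.2 =
      ∑ q ∈ antidiagonal p.2,
        betaCoeff c p.1 * divPow (-c (p.1 + 1)) q.1 * divPow x q.2 := fun p => by
    rw [show x - c (p.1 + 1) = -c (p.1 + 1) + x by ring, divPow_add, Finset.mul_sum]
    exact Finset.sum_congr rfl fun q _ => by ring
  rw [Finset.sum_congr rfl fun p _ => h p,
    ← sum_antidiagonal_assoc (fun i j k => betaCoeff c i * divPow (-c (i + 1)) j * divPow x k)]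
  simp only [← Finset.sum_mul, sum_betaCoeff_mul_divPow_neg]
  rw [← divPow_add, zero_add]

/-- The system is triangular with unit diagonal, so one point x suffices. -/
lemma eq_of_sum_mul_divPow_eq {b b' : ℕ → ℝ} {x : ℝ} (n : ℕ)
    (h : ∀ m ≤ n, ∑ p ∈ antidiagonal m, b p.1 * divPow (x - c (p.1 + 1)) p.2
      = ∑ p ∈ antidiagonal m, b' p.1 * divPow (x - c (p.1 + 1)) p.2) :
    b n = b' n := by
  induction n using Nat.strong_induction_on with
  | _ n ih =>
    have hn := h n le_rfl
    simp only [Finset.Nat.sum_antidiagonal_eq_sum_range_succ_mk, Finset.sum_range_succ,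
      Nat.sub_self, divPow_zero, mul_one] at hn
    rw [Finset.sum_congr rfl fun j hj => by
      rw [ih j (Finset.mem_range.1 hj) fun m hm =>
        h m (hm.trans (Finset.mem_range.1 hj).le)]] at hn
    linarith

/-- Uniqueness of the Abel–Gončarov coefficients. -/
lemma eq_betaCoeff {b : ℕ → ℝ} {x : ℝ} (n : ℕ)
    (h : ∀ m ≤ n, ∑ p ∈ antidiagonal m, b p.1 * divPow (x - c (p.1 + 1)) p.2
      = divPow x m) : b n = betaCoeff c n :=
  eq_of_sum_mul_divPow_eq c n fun m hm => by rw [h m hm, sum_betaCoeff_mul_divPow]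

lemma betaCoeff_congr {c c' : ℕ → ℝ} {n : ℕ} (h : ∀ i, 1 ≤ i → i ≤ n → c i = c' i) :
    betaCoeff c n = betaCoeff c' n := by
  refine eq_betaCoeff (x := 0) c' n fun m hm => ?_
  rw [← sum_betaCoeff_mul_divPow c 0 m]
  refine Finset.sum_congr rfl fun p hp => ?_
  have := mem_antidiagonal.1 hp
  rcases p with ⟨i, j⟩
  rcases j with _ | j
  · simp
  · simp only at this
    rw [h (i + 1) (by omega) (by omega)]

/-- Homogeneity of degree n; it converts the probabilities c_i / N into the levels c_i. -/
lemma betaCoeff_div (a : ℝ) (n : ℕ) :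
    betaCoeff (fun i => c i / a) n = betaCoeff c n / a ^ n := by
  symm
  refine eq_betaCoeff (b := fun n => betaCoeff c n / a ^ n) (x := 0) _ n fun m _ => ?_
  have h := sum_betaCoeff_mul_divPow_neg c m
  calc _ = ∑ p ∈ antidiagonal m,
        (betaCoeff c p.1 * divPow (-c (p.1 + 1)) p.2) / a ^ m := by
        refine Finset.sum_congr rfl fun p hp => ?_
        obtain rfl := mem_antidiagonal.1 hp
        rw [show 0 - c (p.1 + 1) / a = -c (p.1 + 1) / a by ring]
        simp only [divPow, div_pow, pow_add]
        ring
    _ = divPow 0 m / a ^ m := by rw [← Finset.sum_div, h]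
    _ = divPow 0 m := by rcases m with _ | m <;> simp [divPow]

/-- Taylor expansion of the Gončarov polynomials under a common shift of the levels. -/
lemma betaCoeff_eq_sum_shift (x : ℝ) (n : ℕ) :
    betaCoeff c n = ∑ p ∈ antidiagonal n,
      divPow x p.1 * betaCoeff (fun i => c (p.1 + i) - x) p.2 := by
  symm
  refine eq_betaCoeff (b := fun n => ∑ p ∈ antidiagonal n,
    divPow x p.1 * betaCoeff (fun i => c (p.1 + i) - x) p.2) (x := x) c n fun m _ => ?_
  simp only [Finset.sum_mul]
  have h : ∀ p : ℕ × ℕ, ∑ q ∈ antidiagonal p.1,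
      divPow x q.1 * betaCoeff (fun i => c (q.1 + i) - x) q.2 * divPow (x - c (p.1 + 1)) p.2
      = ∑ q ∈ antidiagonal p.1,
      divPow x q.1 * betaCoeff (fun i => c (q.1 + i) - x) q.2 *
        divPow (x - c (q.1 + (q.2 + 1))) p.2 := fun p =>
    Finset.sum_congr rfl fun q hq => by
      rw [← mem_antidiagonal.1 hq, add_assoc]
  rw [Finset.sum_congr rfl fun p _ => h p, sum_antidiagonal_assoc (fun i j k =>
    divPow x i * betaCoeff (fun r => c (i + r) - x) j * divPow (x - c (i + (j + 1))) k)]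
  have h2 : ∀ p : ℕ × ℕ, ∑ q ∈ antidiagonal p.2, divPow x p.1 *
      betaCoeff (fun r => c (p.1 + r) - x) q.1 * divPow (x - c (p.1 + (q.1 + 1))) q.2
      = divPow x p.1 * divPow 0 p.2 := fun p => by
    rw [← sum_betaCoeff_mul_divPow (fun r => c (p.1 + r) - x) 0 p.2, Finset.mul_sum]
    refine Finset.sum_congr rfl fun q _ => ?_
    rw [zero_sub, neg_sub, mul_assoc]
  rw [Finset.sum_congr rfl fun p _ => h2 p, ← divPow_add, add_zero]

lemma betaCoeff_eq_zero {n : ℕ} (hn : n ≠ 0) (h : c 1 = 0) : betaCoeff c n = 0 := by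
  have := eq_betaCoeff (b := fun i => if i = 0 then 1 else 0) (x := 0) c n fun m _ => by
    rw [Finset.Nat.sum_antidiagonal_eq_sum_range_succ_mk, Finset.sum_range_succ']
    simp [h]
  rw [← this, if_neg hn]

/-- Shift by c_1. The term of full order n vanishes because its first level is 0; the others have
smaller order and levels that are again nonnegative and nondecreasing. -/
lemma betaCoeff_nonneg {c : ℕ → ℝ} (h0 : 0 ≤ c 1) (hc : ∀ i, 1 ≤ i → c i ≤ c (i + 1)) (n : ℕ) :
    0 ≤ betaCoeff c n := by
  induction n using Nat.strong_induction_on generalizing c with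
  | _ n ih =>
    rcases Nat.eq_zero_or_pos n with rfl | hn
    · rw [betaCoeff_zero]; exact zero_le_one
    have hle : ∀ i, c 1 ≤ c (i + 1) := fun i => by
      induction i with
      | zero => rfl
      | succ i hi => exact hi.trans (hc _ (by omega))
    rw [betaCoeff_eq_sum_shift c (c 1) n]
    refine Finset.sum_nonneg fun p hp => ?_
    rcases p with ⟨i, j⟩
    have hij : i + j = n := mem_antidiagonal.1 hp
    refine mul_nonneg (divPow_nonneg h0 _) ?_
    rcases Nat.eq_zero_or_pos i with rfl | _
    · rw [betaCoeff_eq_zero _ (by simp only; omega) (by simp)]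
    · exact ih j (by omega) (by simpa using hle i)
        fun r hr => sub_le_sub_right (by simpa [add_assoc] using hc (i + r) (by omega)) _

/-- A single term of the shift expansion, all of whose terms are nonnegative. -/
lemma le_betaCoeff {c : ℕ → ℝ} (h0 : 0 ≤ c 1) (hc : ∀ i, 1 ≤ i → c i ≤ c (i + 1)) (i j : ℕ) :
    divPow (c 1) i * betaCoeff (fun r => c (i + r) - c 1) j ≤ betaCoeff c (i + j) := by
  have hle : ∀ i, c 1 ≤ c (i + 1) := fun i => by
    induction i with
    | zero => rfl
    | succ i hi => exact hi.trans (hc _ (by omega))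
  rw [betaCoeff_eq_sum_shift c (c 1) (i + j)]
  refine Finset.single_le_sum
    (f := fun p : ℕ × ℕ => divPow (c 1) p.1 * betaCoeff (fun r => c (p.1 + r) - c 1) p.2)
    (fun p _ => ?_) (mem_antidiagonal.2 (rfl : (i, j).1 + (i, j).2 = i + j))
  refine mul_nonneg (divPow_nonneg h0 _) (betaCoeff_nonneg (by simpa using hle p.1) ?_ _)
  rcases Nat.eq_zero_or_pos p.1 with h | _
  · intro r hr
    simpa [h] using hc r hr
  · exact fun r hr => sub_le_sub_right (by simpa [add_assoc] using hc (p.1 + r) (by omega)) _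

/-- The Abel polynomials `t (t + n) ^ (n - 1) / n!`. -/
noncomputable def abelCoeff (t : ℝ) (n : ℕ) : ℝ :=
  if n = 0 then 1 else t * (t + n) ^ (n - 1) / (n.factorial : ℝ)

/-- Up to a factor, the sum of order n + 1 is the (n+1)-st finite difference of the n-th power,
hence zero. -/
lemma sum_abelCoeff_mul_divPow_neg (t : ℝ) (n : ℕ) :
    ∑ p ∈ antidiagonal n, abelCoeff t p.1 * divPow (-(t + p.1)) p.2 = divPow 0 n := by
  rcases n with _ | n
  · simp [abelCoeff]
  have h := congrFun (fwdDiff_iter_pow_eq_zero_of_lt (R := ℝ) (Nat.lt_succ_self n)) t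
  rw [fwdDiff_iter_eq_sum_shift] at h
  rw [Finset.Nat.sum_antidiagonal_eq_sum_range_succ_mk, divPow_zero_left,
    if_neg (Nat.succ_ne_zero n)]
  have h2 : ∀ k ∈ Finset.range (n + 1 + 1),
      abelCoeff t k * divPow (-(t + k)) (n + 1 - k) = t / ((n + 1).factorial : ℝ) *
      (((-1 : ℤ) ^ (n + 1 - k) * ((n + 1).choose k : ℤ)) • (t + k • (1 : ℝ)) ^ n) := by
    intro k hk
    have hk' : k ≤ n + 1 := Nat.lt_succ_iff.1 (Finset.mem_range.1 hk)
    have hch : ((n + 1).choose k : ℝ) = (n + 1).factorial / (k.factorial * (n + 1 - k).factorial) :=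
      Nat.cast_choose ℝ hk'
    rw [zsmul_eq_mul, nsmul_eq_mul, mul_one]
    push_cast
    rw [hch]
    unfold abelCoeff divPow
    rw [neg_pow]
    rcases k with _ | k
    · simp
      field_simp
      ring
    · have : n = k + (n + 1 - (k + 1)) := by omega
      rw [if_neg (Nat.succ_ne_zero k), Nat.add_sub_cancel]
      conv_rhs => rw [show (t + ((k + 1 : ℕ) : ℝ)) ^ n =
        (t + ((k + 1 : ℕ) : ℝ)) ^ k * (t + ((k + 1 : ℕ) : ℝ)) ^ (n + 1 - (k + 1)) by
          rw [← pow_add, ← this]]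
      field_simp
  rw [Finset.sum_congr rfl h2, ← Finset.mul_sum]
  simp only [Nat.succ_eq_add_one] at h
  rw [h, Pi.zero_apply, mul_zero]

lemma betaCoeff_linear {c : ℕ → ℝ} (t : ℝ) (hc : ∀ i, 1 ≤ i → c i = t + i - 1) (n : ℕ) :
    betaCoeff c n = abelCoeff t n := by
  symm
  refine eq_betaCoeff (x := 0) c n fun m _ => ?_
  rw [← sum_abelCoeff_mul_divPow_neg t m]
  refine Finset.sum_congr rfl fun p _ => ?_
  rw [hc _ (by omega)]
  congr 2
  push_cast; ring

/-- Abel's binomial identity. -/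
lemma sum_abelCoeff_mul_divPow (t x : ℝ) (n : ℕ) :
    ∑ p ∈ antidiagonal n, abelCoeff t p.1 * divPow (x - p.1) p.2 = divPow (x + t) n := by
  rw [← sum_betaCoeff_mul_divPow (fun i => t + i - 1) (x + t) n]
  refine Finset.sum_congr rfl fun p _ => ?_
  rw [betaCoeff_linear t fun i _ => rfl]
  congr 2
  push_cast; ring

/-- Expansion of Abel polynomials in terms of the coefficients for arbitrary levels. -/
lemma sum_betaCoeff_mul_abelCoeff (t : ℝ) (n : ℕ) :
    ∑ p ∈ antidiagonal n, betaCoeff c p.1 * abelCoeff (t + p.1 - c (p.1 + 1)) p.2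
      = abelCoeff t n := by
  -- Levels i - 2 and x = -1 make the base of the p-th divided power equal to -p, so Abel's identity
  -- evaluates both sides to `divPow t m`.
  refine eq_of_sum_mul_divPow_eq (b := fun n => ∑ p ∈ antidiagonal n,
    betaCoeff c p.1 * abelCoeff (t + p.1 - c (p.1 + 1)) p.2) (b' := abelCoeff t) (x := -1)
    (fun i => (i : ℝ) - 2) n fun m _ => ?_
  simp only [Finset.sum_mul]
  have h : ∀ p : ℕ × ℕ, ∑ q ∈ antidiagonal p.1,
      betaCoeff c q.1 * abelCoeff (t + q.1 - c (q.1 + 1)) q.2 *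
        divPow (-1 - (((p.1 + 1 : ℕ) : ℝ) - 2)) p.2 = ∑ q ∈ antidiagonal p.1,
      betaCoeff c q.1 * abelCoeff (t + q.1 - c (q.1 + 1)) q.2 * divPow (-q.1 - q.2) p.2 :=
    fun p => Finset.sum_congr rfl fun q hq => by
      rw [← mem_antidiagonal.1 hq]
      congr 2
      push_cast; ring
  rw [Finset.sum_congr rfl fun p _ => h p, sum_antidiagonal_assoc (fun i j k =>
    betaCoeff c i * abelCoeff (t + i - c (i + 1)) j * divPow (-(i : ℝ) - j) k)]
  simp only [mul_assoc, ← Finset.mul_sum, sum_abelCoeff_mul_divPow]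
  have h3 : ∀ p : ℕ × ℕ, abelCoeff t p.1 * divPow (-1 - (((p.1 + 1 : ℕ) : ℝ) - 2)) p.2
      = abelCoeff t p.1 * divPow (0 - p.1) p.2 := fun p => by
    congr 2
    push_cast; ring
  rw [Finset.sum_congr rfl fun p _ => h3 p, sum_abelCoeff_mul_divPow,
    zero_add, ← sum_betaCoeff_mul_divPow c t m]
  refine Finset.sum_congr rfl fun p _ => ?_
  congr 2
  ring

end Goncarov

/-! ### Crossing probabilities of an i.i.d. sample -/

section Crossing

variable {ι : Type*}

/-- The samples `x` for which at least `i` of the coordinates in `s` are at most `l i`,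
for all `1 ≤ i ≤ r`. -/
def ballotSet (l : ℕ → ℝ) (s : Finset ι) (r : ℕ) : Set (ι → ℝ) :=
  {x | ∀ i, 1 ≤ i → i ≤ r → i ≤ (s.filter fun a => x a ≤ l i).card}

lemma measurableSet_ballotSet (l : ℕ → ℝ) (s : Finset ι) (r : ℕ) :
    MeasurableSet (ballotSet l s r) := by
  unfold ballotSet
  simp only [Set.ofPred_forall, Finset.card_filter]
  refine MeasurableSet.iInter fun i => MeasurableSet.iInter fun _ => MeasurableSet.iInter fun _ =>
    measurableSet_le measurable_const (Finset.measurable_sum _ fun a _ => ?_)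
  exact Measurable.ite (measurableSet_le (measurable_pi_apply a) measurable_const)
    measurable_const measurable_const

lemma measurableSet_forall_lt (l : ℝ) (u : Finset ι) :
    MeasurableSet {x : ι → ℝ | ∀ a ∈ u, l < x a} := by
  simp only [Set.ofPred_forall]
  exact MeasurableSet.biInter u.countable_toSet fun a _ =>
    measurableSet_lt measurable_const (measurable_pi_apply a)

lemma le_of_mem_ballotSet {l : ℕ → ℝ} {t : Finset ι} {x : ι → ℝ} (h : x ∈ ballotSet l t t.card)
    {a : ι} (ha : a ∈ t) : x a ≤ l t.card := by
  have hc := Finset.eq_of_subset_of_card_le (Finset.filter_subset (fun a => x a ≤ l t.card) t)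
    (h t.card (Finset.card_pos.2 ⟨a, ha⟩) le_rfl)
  rw [← hc] at ha
  exact (Finset.mem_filter.1 ha).2

variable [DecidableEq ι]

/-- The samples for which the first violated constraint has index `#t + 1`, and the coordinates
in `s` that are at most `l (#t + 1)` are those in `t`. -/
def firstFailSet (l : ℕ → ℝ) (s t : Finset ι) : Set (ι → ℝ) :=
  ballotSet l t t.card ∩ {x | ∀ a ∈ s \ t, l (t.card + 1) < x a}

lemma measurableSet_firstFailSet (l : ℕ → ℝ) (s t : Finset ι) :
    MeasurableSet (firstFailSet l s t) :=
  (measurableSet_ballotSet _ _ _).inter (measurableSet_forall_lt _ _)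

lemma filter_subset_of_mem_firstFailSet {l : ℕ → ℝ} {s t : Finset ι} {x : ι → ℝ}
    (h : x ∈ firstFailSet l s t) : (s.filter fun a => x a ≤ l (t.card + 1)) ⊆ t := by
  intro a ha
  rw [Finset.mem_filter] at ha
  by_contra hat
  exact absurd (h.2 a (Finset.mem_sdiff.2 ⟨ha.1, hat⟩)) (not_lt.2 ha.2)

lemma filter_eq_of_mem_firstFailSet {l : ℕ → ℝ} {s t : Finset ι} {x : ι → ℝ} {r : ℕ}
    (hl : MonotoneOn l (Set.Icc 1 r)) (hts : t ⊆ s) (htr : t.card < r)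
    (h : x ∈ firstFailSet l s t) : (s.filter fun a => x a ≤ l (t.card + 1)) = t := by
  refine Finset.Subset.antisymm (filter_subset_of_mem_firstFailSet h) fun a ha => ?_
  have hpos : 1 ≤ t.card := Finset.card_pos.2 ⟨a, ha⟩
  exact Finset.mem_filter.2 ⟨hts ha, (le_of_mem_ballotSet h.1 ha).trans
    (hl ⟨hpos, htr.le⟩ ⟨by omega, htr⟩ (Nat.le_succ _))⟩

/-- If the first violated index is j + 1, monotonicity of `l` forces exactly j coordinates to be at
most l (j + 1); these form `t`. -/
lemma compl_ballotSet_eq {l : ℕ → ℝ} {s : Finset ι} {r : ℕ}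
    (hl : MonotoneOn l (Set.Icc 1 r)) :
    (ballotSet l s r)ᶜ = ⋃ t ∈ s.powerset.filter (fun t => t.card < r), firstFailSet l s t := by
  ext x
  simp only [Set.mem_compl_iff, Set.mem_iUnion, Finset.mem_filter, Finset.mem_powerset,
    exists_prop]
  constructor
  · intro hx
    have hex : ∃ i, 1 ≤ i ∧ i ≤ r ∧ (s.filter fun a => x a ≤ l i).card < i := by
      by_contra! hcon
      exact hx hcon
    classical
    obtain ⟨h1, hr, hlt⟩ := Nat.find_spec hex
    have hmin : ∀ i, 1 ≤ i → i < Nat.find hex → i ≤ (s.filter fun a => x a ≤ l i).card := by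
      intro i hi1 hi
      have := Nat.find_min hex hi
      by_contra! hcon
      exact this ⟨hi1, by omega, hcon⟩
    obtain ⟨j, hj⟩ : ∃ j, Nat.find hex = j + 1 := ⟨Nat.find hex - 1, by omega⟩
    rw [hj] at hr hlt hmin
    have hsub : ∀ i, 1 ≤ i → i ≤ j → ∀ a, x a ≤ l i → x a ≤ l (j + 1) := fun i hi1 hi a ha =>
      ha.trans (hl ⟨hi1, by omega⟩ ⟨by omega, hr⟩ (by omega))
    have hcard : (s.filter fun a => x a ≤ l (j + 1)).card = j := by
      refine le_antisymm (by omega) ?_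
      rcases Nat.eq_zero_or_pos j with rfl | hpos
      · exact Nat.zero_le _
      · exact (hmin j hpos (by omega)).trans (Finset.card_le_card
          (Finset.monotone_filter_right s fun a _ => hsub j hpos le_rfl a))
    refine ⟨s.filter fun a => x a ≤ l (j + 1), ⟨Finset.filter_subset _ _, by omega⟩, ?_, ?_⟩
    · rw [hcard]
      intro i hi1 hi
      rw [Finset.filter_filter]
      refine (hmin i hi1 (by omega)).trans (Finset.card_le_card
          (Finset.monotone_filter_right s fun a _ ha => ⟨hsub i hi1 hi a ha, ha⟩))
    · rw [hcard]
      intro a ha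
      rw [Finset.mem_sdiff, Finset.mem_filter] at ha
      by_contra! hcon
      exact ha.2 ⟨ha.1, hcon⟩
  · rintro ⟨t, ⟨_, htr⟩, hx⟩ hcon
    have h1 := hcon (t.card + 1) (by omega) htr
    have h2 := Finset.card_le_card (filter_subset_of_mem_firstFailSet hx)
    omega

lemma pairwiseDisjoint_firstFailSet {l : ℕ → ℝ} {s : Finset ι} {r : ℕ}
    (hl : MonotoneOn l (Set.Icc 1 r)) :
    Set.PairwiseDisjoint (↑(s.powerset.filter fun t => t.card < r)) (firstFailSet l s) := by
  intro t ht u hu htu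
  simp only [Finset.coe_filter, Finset.mem_powerset, Set.mem_ofPred_eq] at ht hu
  have key : ∀ t u : Finset ι, t ⊆ s → u ⊆ s → ∀ x, x ∈ firstFailSet l s t →
      x ∈ firstFailSet l s u → ¬ t.card < u.card := by
    intro t u _ hus x hxt hxu hlt
    have h1 := hxu.1 (t.card + 1) (by omega) hlt
    have h2 := Finset.card_le_card (filter_subset_of_mem_firstFailSet hxt)
    have h3 := Finset.card_le_card
      (Finset.filter_subset_filter (fun a => x a ≤ l (t.card + 1)) hus)
    omega
  refine Set.disjoint_left.2 fun x hxt hxu => htu ?_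
  have hc : t.card = u.card := le_antisymm
    (not_lt.1 (key u t hu.1 ht.1 x hxu hxt)) (not_lt.1 (key t u ht.1 hu.1 x hxt hxu))
  rw [← filter_eq_of_mem_firstFailSet hl ht.1 ht.2 hxt,
    ← filter_eq_of_mem_firstFailSet hl hu.1 hu.2 hxu, hc]

variable [Fintype ι] (ν : Measure ℝ) [IsProbabilityMeasure ν]

lemma pi_real_forall_lt (l : ℝ) (u : Finset ι) :
    (Measure.pi fun _ : ι => ν).real {x | ∀ a ∈ u, l < x a} = (1 - cdf ν l) ^ u.card := by
  have h : {x : ι → ℝ | ∀ a ∈ u, l < x a}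
      = Set.univ.pi fun a => if a ∈ u then Set.Ioi l else Set.univ := by
    ext x
    simp only [Set.mem_ofPred_eq, Set.mem_pi, Set.mem_univ, forall_const]
    refine forall_congr' fun a => ?_
    by_cases ha : a ∈ u <;> simp [ha]
  have h2 : ν.real (Set.Ioi l) = 1 - cdf ν l := by
    rw [cdf_eq_real, ← Set.compl_Iic, probReal_compl_eq_one_sub measurableSet_Iic]
  rw [h, measureReal_def, Measure.pi_pi, ENNReal.toReal_prod, ← h2, ← Finset.prod_const,
    ← Finset.prod_subset (Finset.subset_univ u)]
  · exact Finset.prod_congr rfl fun a ha => by simp [ha, measureReal_def]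
  · intro a _ ha
    simp [ha]

/-- The two conditions involve the coordinates in `t` and in `s \ t` separately, so they are
independent. -/
lemma pi_real_firstFailSet (l : ℕ → ℝ) (s t : Finset ι) :
    (Measure.pi fun _ : ι => ν).real (firstFailSet l s t) =
      (Measure.pi fun _ : ι => ν).real (ballotSet l t t.card) *
        (1 - cdf ν (l (t.card + 1))) ^ (s \ t).card := by
  have hind : iIndepFun (fun (a : ι) (x : ι → ℝ) => x a) (Measure.pi fun _ : ι => ν) :=
    iIndepFun_pi (X := fun _ x => x) fun _ => aemeasurable_id
  have h2 := hind.indepFun_finset t (s \ t) Finset.disjoint_sdiff fun a => measurable_pi_apply a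
  -- Extension by zero turns events on full samples into events on restricted samples, as
  -- independence of finite subfamilies requires.
  have ext_meas : ∀ t : Finset ι, Measurable fun (y : t → ℝ) (a : ι) =>
      if h : a ∈ t then y ⟨a, h⟩ else 0 := fun t => by
    refine measurable_pi_lambda _ fun a => ?_
    by_cases ha : a ∈ t
    · simp only [ha, dif_pos]; exact measurable_pi_apply _
    · simp only [ha, dif_neg, not_false_eq_true]; exact measurable_const
  have h3 := IndepFun.measure_inter_preimage_eq_mul h2
    ((fun (y : t → ℝ) (a : ι) => if h : a ∈ t then y ⟨a, h⟩ else 0) ⁻¹' ballotSet l t t.card)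
    ((fun (y : (s \ t : Finset ι) → ℝ) (a : ι) => if h : a ∈ s \ t then y ⟨a, h⟩ else 0) ⁻¹'
      {x | ∀ a ∈ s \ t, l (t.card + 1) < x a})
    (ext_meas t (measurableSet_ballotSet _ _ _))
    (ext_meas (s \ t) (measurableSet_forall_lt _ _))
  have e1 : (fun (x : ι → ℝ) (i : t) => x i) ⁻¹'
      ((fun (y : t → ℝ) (a : ι) => if h : a ∈ t then y ⟨a, h⟩ else 0) ⁻¹' ballotSet l t t.card)
      = ballotSet l t t.card := by
    ext x
    simp only [ballotSet, Set.mem_preimage, Set.mem_ofPred_eq]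
    refine forall_congr' fun i => ?_
    rw [Finset.filter_congr fun a ha => by rw [dif_pos ha]]
  have e2 : (fun (x : ι → ℝ) (i : (s \ t : Finset ι)) => x i) ⁻¹'
      ((fun (y : (s \ t : Finset ι) → ℝ) (a : ι) => if h : a ∈ s \ t then y ⟨a, h⟩ else 0) ⁻¹'
        {x | ∀ a ∈ s \ t, l (t.card + 1) < x a}) = {x | ∀ a ∈ s \ t, l (t.card + 1) < x a} := by
    ext x
    simp only [Set.mem_preimage, Set.mem_ofPred_eq]
    exact forall₂_congr fun a ha => by rw [dif_pos ha]
  rw [e1, e2] at h3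
  rw [← pi_real_forall_lt, measureReal_def, measureReal_def, measureReal_def,
    ← ENNReal.toReal_mul, ← h3]
  rfl

lemma one_sub_pi_real_ballotSet {l : ℕ → ℝ} {s : Finset ι} {r : ℕ}
    (hl : MonotoneOn l (Set.Icc 1 r)) {b : ℕ → ℝ} (hr : r ≤ s.card)
    (hb : ∀ t ⊆ s, t.card < r → (Measure.pi fun _ : ι => ν).real (ballotSet l t t.card)
      = t.card.factorial * b t.card) :
    1 - (Measure.pi fun _ : ι => ν).real (ballotSet l s r) = s.card.factorial *
      ∑ j ∈ Finset.range r, b j * divPow (1 - cdf ν (l (j + 1))) (s.card - j) := by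
  rw [← probReal_compl_eq_one_sub (measurableSet_ballotSet _ _ _), compl_ballotSet_eq hl,
    measureReal_biUnion_finset (pairwiseDisjoint_firstFailSet hl)
      fun t _ => measurableSet_firstFailSet _ _ _]
  have h1 : ∀ t ∈ s.powerset.filter (fun t => t.card < r),
      (Measure.pi fun _ : ι => ν).real (firstFailSet l s t) =
      t.card.factorial * b t.card *
        (1 - cdf ν (l (t.card + 1))) ^ (s.card - t.card) := fun t ht => by
    simp only [Finset.mem_filter, Finset.mem_powerset] at ht
    rw [pi_real_firstFailSet, hb t ht.1 ht.2, Finset.card_sdiff_of_subset ht.1]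
  rw [Finset.sum_congr rfl h1, Finset.sum_filter, Finset.sum_powerset_apply_card
    (fun j => if j < r then (j.factorial : ℝ) * b j *
        (1 - cdf ν (l (j + 1))) ^ (s.card - j) else 0), Finset.mul_sum]
  symm
  refine Finset.sum_subset_zero_on_sdiff (Finset.range_subset_range.2 (by omega)) ?_ ?_
  · intro j hj
    rw [Finset.mem_sdiff, Finset.mem_range, Finset.mem_range] at hj
    rw [if_neg hj.2, smul_zero]
  · intro j hj
    rw [Finset.mem_range] at hj
    rw [if_pos hj, nsmul_eq_mul, Nat.cast_choose ℝ (by omega : j ≤ s.card)]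
    unfold divPow
    field_simp

/-- By strong induction: the first-failure formula is the Abel–Gončarov expansion at x = 1 without
its last term. -/
lemma pi_real_ballotSet_card {l : ℕ → ℝ} {K : ℕ} (hl : MonotoneOn l (Set.Icc 1 K))
    (s : Finset ι) (hs : s.card ≤ K) :
    (Measure.pi fun _ : ι => ν).real (ballotSet l s s.card)
      = s.card.factorial * betaCoeff (fun i => cdf ν (l i)) s.card := by
  induction hn : s.card using Nat.strong_induction_on generalizing s with
  | _ n ih =>
    subst hn
    have h := one_sub_pi_real_ballotSet ν (b := betaCoeff fun i => cdf ν (l i))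
      (hl.mono (Set.Icc_subset_Icc_right hs)) le_rfl
      fun t _ ht => ih t.card ht t (by omega) rfl
    have h2 := sum_betaCoeff_mul_divPow (fun i => cdf ν (l i)) 1 s.card
    rw [Finset.Nat.sum_antidiagonal_eq_sum_range_succ_mk, Finset.sum_range_succ] at h2
    simp only [Nat.sub_self, divPow_zero, mul_one] at h2
    rw [eq_sub_of_add_eq h2] at h
    have h3 : (s.card.factorial : ℝ) * divPow 1 s.card = 1 := by
      unfold divPow; field_simp; simp
    rw [mul_sub, h3] at h
    linarith

/-- The complement involves only p_1, …, p_r, while the whole expansion at 1 holds for all levels;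
hence `p` is free beyond r. -/
lemma pi_real_ballotSet {l : ℕ → ℝ} {r : ℕ} (hl : MonotoneOn l (Set.Icc 1 r))
    {s : Finset ι} (hr : r ≤ s.card) {p : ℕ → ℝ}
    (hp : ∀ i, 1 ≤ i → i ≤ r → cdf ν (l i) = p i) :
    (Measure.pi fun _ : ι => ν).real (ballotSet l s r) = s.card.factorial *
      ∑ j ∈ Finset.Ico r (s.card + 1), betaCoeff p j * divPow (1 - p (j + 1)) (s.card - j) := by
  have h := one_sub_pi_real_ballotSet ν (b := betaCoeff fun i => cdf ν (l i)) hl hr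
    fun t _ ht => pi_real_ballotSet_card ν hl t ht.le
  have h2 := sum_betaCoeff_mul_divPow p 1 s.card
  rw [Finset.Nat.sum_antidiagonal_eq_sum_range_succ_mk,
    ← Finset.sum_range_add_sum_Ico _ (by omega : r ≤ s.card + 1)] at h2
  have h4 : ∀ j ∈ Finset.range r, betaCoeff (fun i => cdf ν (l i)) j *
      divPow (1 - cdf ν (l (j + 1))) (s.card - j)
      = betaCoeff p j * divPow (1 - p (j + 1)) (s.card - j) := fun j hj => by
    have hj' := Finset.mem_range.1 hj
    rw [hp _ (by omega) hj', betaCoeff_congr fun i hi1 hi2 => hp i hi1 (by omega)]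
  rw [Finset.sum_congr rfl h4, eq_sub_of_add_eq h2] at h
  have h3 : (s.card.factorial : ℝ) * divPow 1 s.card = 1 := by
    unfold divPow; field_simp; simp
  rw [mul_sub, h3] at h
  linarith

end Crossing

/-! ### Exact law of the number of failed lines -/

lemma orderStat_le_iff {N : ℕ} (x : Fin N → ℝ) (i : Fin N) (a : ℝ) :
    orderStat x i ≤ a ↔ (i : ℕ) + 1 ≤ (Finset.univ.filter fun j => x j ≤ a).card := by
  have h := Tuple.lt_card_le_iff_apply_le_of_monotone (j := i) (a := a) (Tuple.monotone_sort x)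
  have hc : (Finset.univ.filter fun j => (x ∘ Tuple.sort x) j ≤ a).card
      = (Finset.univ.filter fun j => x j ≤ a).card :=
    Finset.card_equiv (Tuple.sort x) (by simp)
  rw [hc] at h
  exact h.symm

lemma le_failedLines_iff {N K : ℕ} (hK : K ≤ N) (l : ℕ → ℝ) (x : Fin N → ℝ) :
    K ≤ failedLines l x ↔ x ∈ ballotSet l Finset.univ K := by
  set S := {m : ℕ | m ≤ N ∧ ∀ i : Fin N, (i : ℕ) < m → orderStat x i ≤ l (i + 1)} with hS
  have hbdd : BddAbove S := ⟨N, fun m hm => hm.1⟩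
  have hmem : sSup S ∈ S := Nat.sSup_mem ⟨0, Nat.zero_le _, fun i hi => absurd hi (by omega)⟩ hbdd
  have h1 : K ≤ failedLines l x ↔ K ∈ S :=
    ⟨fun h => ⟨hK, fun i hi => hmem.2 i (lt_of_lt_of_le hi h)⟩, fun h => le_csSup hbdd h⟩
  rw [h1]
  constructor
  · rintro ⟨_, h⟩ i hi1 hi
    have := (orderStat_le_iff x ⟨i - 1, by omega⟩ _).1 (h ⟨i - 1, by omega⟩ (by simp only; omega))
    simpa only [Nat.sub_add_cancel hi1] using this
  · intro h
    exact ⟨hK, fun i hi => (orderStat_le_iff x i _).2 (h (i + 1) (by omega) (by omega))⟩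

/-- The exact probability that at least `K` lines fail, as a sum over the tail of an
Abel–Gončarov expansion. -/
lemma measureReal_le_failedLines {Ω : Type*} [MeasurableSpace Ω] {P : Measure Ω}
    [IsProbabilityMeasure P] {ν : Measure ℝ} [IsProbabilityMeasure ν] {N K : ℕ}
    {C : Fin N → Ω → ℝ} (hlaw : ∀ j, HasLaw (C j) ν P) (hindep : iIndepFun C P)
    (hN : N ≠ 0) (hK : K ≤ N) {l : ℕ → ℝ} (hl : MonotoneOn l (Set.Icc 1 K)) {c : ℕ → ℝ}
    (hc : ∀ i, 1 ≤ i → i ≤ K → cdf ν (l i) = c i / N) :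
    P.real {ω | K ≤ failedLines l fun j => C j ω} = N.factorial / (N : ℝ) ^ N *
      ∑ j ∈ Finset.Ico K (N + 1), betaCoeff c j * divPow (N - c (j + 1)) (N - j) := by
  have hmap := (iIndepFun_iff_map_fun_eq_pi_map fun j => (hlaw j).aemeasurable).1 hindep
  simp only [fun j => (hlaw j).map_eq] at hmap
  have h1 : {ω | K ≤ failedLines l fun j => C j ω}
      = (fun ω j => C j ω) ⁻¹' ballotSet l Finset.univ K := by
    ext ω
    exact le_failedLines_iff hK l _
  rw [h1, ← map_measureReal_apply_of_aemeasurable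
    (aemeasurable_pi_lambda _ fun j => (hlaw j).aemeasurable) (measurableSet_ballotSet _ _ _),
    hmap, pi_real_ballotSet ν hl (by simpa using hK) hc, Finset.card_univ, Fintype.card_fin,
    div_mul_eq_mul_div, mul_div_assoc, Finset.sum_div]
  congr 1
  refine Finset.sum_congr rfl fun j hj => ?_
  have hN' : (N : ℝ) ≠ 0 := Nat.cast_ne_zero.2 hN
  have hj' : j + (N - j) = N := by
    have := Finset.mem_Ico.1 hj
    omega
  rw [betaCoeff_div, show 1 - c (j + 1) / N = (N - c (j + 1)) / N by field_simp]
  have hpow : (N : ℝ) ^ N = N ^ j * N ^ (N - j) := by rw [← pow_add, hj']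
  rw [hpow]
  unfold divPow
  rw [div_pow]
  field_simp

/-! ### Incomplete gamma functions and the constant -/

section IncompleteGamma

/-- The weighted partial sum `∑_{i ≤ m} (m - i) x ^ i / i!` of the exponential series. -/
noncomputable def weightedExpSum (m : ℕ) (x : ℝ) : ℝ :=
  ∑ p ∈ antidiagonal m, divPow x p.1 * p.2

lemma hasDerivAt_divPow_succ (n : ℕ) (x : ℝ) :
    HasDerivAt (fun x => divPow x (n + 1)) (divPow x n) x := by
  unfold divPow
  refine ((hasDerivAt_pow (n + 1) x).div_const _).congr_deriv ?_
  rw [Nat.factorial_succ]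
  push_cast
  field_simp

lemma hasDerivAt_exp_neg_mul_sum_divPow (m : ℕ) (x : ℝ) :
    HasDerivAt (fun x => -(Real.exp (-x) * ∑ i ∈ Finset.range (m + 1), divPow x i))
      (divPow x m * Real.exp (-x)) x := by
  have hexp : HasDerivAt (fun x : ℝ => Real.exp (-x)) (-Real.exp (-x)) x := by
    simpa using (hasDerivAt_neg x).exp
  induction m with
  | zero => simpa [Function.comp_def, Pi.neg_def] using hexp.neg
  | succ m ih =>
    simp only [Finset.sum_range_succ _ (m + 1), mul_add, neg_add]
    refine (ih.add (hexp.mul (hasDerivAt_divPow_succ m x)).neg).congr_deriv ?_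
    ring

lemma lowerGamma_succ (m : ℕ) (x : ℝ) : lowerGamma (m + 1) x =
    m.factorial * (1 - Real.exp (-x) * ∑ i ∈ Finset.range (m + 1), divPow x i) := by
  have h : ∀ t : ℝ, t ^ ((m : ℝ) + 1 - 1) * Real.exp (-t)
      = m.factorial * (divPow t m * Real.exp (-t)) := fun t => by
    rw [add_sub_cancel_right, Real.rpow_natCast]
    unfold divPow
    field_simp
  unfold lowerGamma
  simp only [h]
  rw [intervalIntegral.integral_const_mul, intervalIntegral.integral_eq_sub_of_hasDerivAt
    (fun t _ => hasDerivAt_exp_neg_mul_sum_divPow m t)]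
  · rw [Finset.sum_range_succ' (fun i => divPow 0 i)]
    simp only [divPow_zero_left, if_neg (Nat.succ_ne_zero _), Finset.sum_const_zero, neg_zero,
      Real.exp_zero, zero_add, if_true]
    ring
  · refine Continuous.intervalIntegrable ?_ _ _
    unfold divPow
    fun_prop

lemma weightedExpSum_eq (m : ℕ) (x : ℝ) : weightedExpSum m x =
    (m - x) * ∑ i ∈ Finset.range (m + 1), divPow x i + x ^ (m + 1) / m.factorial := by
  induction m with
  | zero => simp [weightedExpSum]
  | succ m ih =>
    have h : weightedExpSum (m + 1) x
        = weightedExpSum m x + ∑ i ∈ Finset.range (m + 1), divPow x i := by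
      unfold weightedExpSum
      simp only [Finset.Nat.sum_antidiagonal_eq_sum_range_succ_mk]
      rw [Finset.sum_range_succ, ← Finset.sum_add_distrib]
      simp only [Nat.sub_self, Nat.cast_zero, mul_zero, add_zero]
      refine Finset.sum_congr rfl fun i hi => ?_
      rw [Nat.succ_sub (Nat.lt_succ_iff.1 (Finset.mem_range.1 hi))]
      push_cast; ring
    rw [h, ih, Finset.sum_range_succ _ (m + 1)]
    unfold divPow
    rw [Nat.factorial_succ]
    push_cast
    field_simp
    ring

/-- Convolve the Abel–Gončarov expansion with the sequence k ↦ k; the term i = m drops out because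
its weight is 0. -/
lemma weightedExpSum_eq_sum_betaCoeff (c : ℕ → ℝ) (m : ℕ) (x : ℝ) :
    weightedExpSum m x =
      ∑ i ∈ Finset.range m, betaCoeff c i * weightedExpSum (m - i) (x - c (i + 1)) := by
  have h := sum_antidiagonal_assoc
    (fun i j k => betaCoeff c i * divPow (x - c (i + 1)) j * (k : ℝ)) m
  simp only [← Finset.sum_mul, sum_betaCoeff_mul_divPow] at h
  simp only [mul_assoc, ← Finset.mul_sum] at h
  rw [Finset.Nat.sum_antidiagonal_eq_sum_range_succ_mk (fun p : ℕ × ℕ =>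
    betaCoeff c p.1 * ∑ q ∈ antidiagonal p.2, divPow (x - c (p.1 + 1)) q.1 * (q.2 : ℝ)),
    Finset.sum_range_succ] at h
  refine h.trans ?_
  simp [weightedExpSum]

end IncompleteGamma

lemma truncConst_eq {M : ℕ} (hM : 1 ≤ M) (θ : ℝ) {Δ : ℕ → ℝ} (hΔ : Δ M = 0) :
    truncConst M θ Δ = 2 / Real.sqrt (2 * Real.pi) *
      (θ + ∑ i ∈ Finset.range M, betaCoeff (level θ Δ) i * Δ (i + 1)
        * Real.exp (-level θ Δ (i + 1))) := by
  obtain ⟨m, rfl⟩ : ∃ m, M = m + 1 := ⟨M - 1, by omega⟩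
  unfold truncConst
  set c := level θ Δ with hc
  have hcM : c (m + 1) = θ + m := by
    simp only [hc, level, hΔ]; push_cast; ring
  simp only [Nat.add_sub_cancel]
  congr 1
  have e0 : θ / (m.factorial : ℝ) * lowerGamma ((m + 1 : ℕ) : ℝ) (c (m + 1))
      + c (m + 1) ^ (m + 1) / (m.factorial : ℝ) * Real.exp (-c (m + 1))
      = θ + Real.exp (-c (m + 1)) * weightedExpSum m (c (m + 1)) := by
    have hf : (m.factorial : ℝ) ≠ 0 := by positivity
    rw [weightedExpSum_eq, Nat.cast_succ, lowerGamma_succ,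
      show (m : ℝ) - c (m + 1) = -θ by rw [hcM]; ring]
    field_simp
    ring
  have e1 : ∀ i ∈ Finset.range m, betaCoeff c i * Real.exp (-c (i + 1))
        * (Δ (i + 1) / ((m + 1 - (i + 1)).factorial : ℝ))
        * lowerGamma (((m + 1 : ℕ) : ℝ) - (i + 1 : ℕ) + 1) (c (m + 1) - c (i + 1))
      - betaCoeff c i * ((c (m + 1) - c (i + 1)) ^ (m + 1 - (i + 1) + 1)
          / ((m + 1 - (i + 1)).factorial : ℝ)) * Real.exp (-c (m + 1))
      = betaCoeff c i * Δ (i + 1) * Real.exp (-c (i + 1)) - Real.exp (-c (m + 1)) *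
          (betaCoeff c i * weightedExpSum (m - i) (c (m + 1) - c (i + 1))) := by
    intro i hi
    have hi' : i ≤ m := (Finset.mem_range.1 hi).le
    have hcast : ((m + 1 : ℕ) : ℝ) - (i + 1 : ℕ) = (m - i : ℕ) := by
      rw [Nat.cast_sub hi']; push_cast; ring
    have hf : ((m - i).factorial : ℝ) ≠ 0 := by positivity
    have hexp : Real.exp (-c (i + 1)) * Real.exp (-(c (m + 1) - c (i + 1)))
        = Real.exp (-c (m + 1)) := by
      rw [← Real.exp_add]; congr 1; ring
    -- Since c_M is unperturbed, the coefficient of the gamma term is the linear factor in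
    -- `weightedExpSum_eq`.
    have hy : ((m - i : ℕ) : ℝ) - (c (m + 1) - c (i + 1)) = Δ (i + 1) := by
      rw [hcM, Nat.cast_sub hi']; simp only [hc, level]; push_cast; ring
    rw [hcast, lowerGamma_succ, weightedExpSum_eq, Nat.add_sub_add_right, hy, ← hexp]
    field_simp
    ring
  have e2 : ∀ f : ℕ → ℝ, ∑ j ∈ Finset.Icc 1 m, f j = ∑ i ∈ Finset.range m, f (i + 1) := fun f => by
    rw [← Finset.Ico_add_one_right_eq_Icc, Finset.sum_Ico_eq_sum_range]
    simp [add_comm]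
  rw [e0, e2, e2, add_sub_assoc, ← Finset.sum_sub_distrib]
  simp only [Nat.add_sub_cancel]
  rw [Finset.sum_congr rfl e1, Finset.sum_sub_distrib, ← Finset.mul_sum,
    ← weightedExpSum_eq_sum_betaCoeff, Finset.sum_range_succ, hΔ]
  ring

/-! ### Asymptotics of Abel polynomials and Gončarov numbers -/

section Asymptotics

variable {α : Type*} {f : Filter α}

/-- Take logarithms and squeeze with 1 - 1/y ≤ log y ≤ y - 1. -/
lemma tendsto_one_add_div_pow {n : α → ℕ} (hn : Tendsto n f atTop) {x : α → ℝ} {τ : ℝ}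
    (hx : Tendsto x f (𝓝 τ)) :
    Tendsto (fun a => (1 + x a / n a) ^ n a) f (𝓝 (Real.exp τ)) := by
  have hn' : Tendsto (fun a => (n a : ℝ)) f atTop := tendsto_natCast_atTop_atTop.comp hn
  have hy : Tendsto (fun a => 1 + x a / n a) f (𝓝 1) := by
    simpa using (tendsto_const_nhds (x := (1 : ℝ))).add (hx.div_atTop hn')
  have hpos : ∀ᶠ a in f, 0 < 1 + x a / n a := hy.eventually_const_lt one_pos
  have hnpos : ∀ᶠ a in f, (0 : ℝ) < n a := hn'.eventually_gt_atTop 0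
  have hlow : Tendsto (fun a => x a / (1 + x a / n a)) f (𝓝 τ) := by
    simpa using! hx.div hy one_ne_zero
  have hlog : Tendsto (fun a => (n a : ℝ) * Real.log (1 + x a / n a)) f (𝓝 τ) := by
    refine tendsto_of_tendsto_of_tendsto_of_le_of_le' hlow hx ?_ ?_
    · filter_upwards [hpos, hnpos] with a h1 h2
      refine le_trans (le_of_eq ?_)
        (mul_le_mul_of_nonneg_left (Real.one_sub_inv_le_log_of_pos h1) h2.le)
      have h3 := h1.ne'
      have : (n a : ℝ) + x a ≠ 0 := by
        rw [show (n a : ℝ) + x a = n a * (1 + x a / n a) by field_simp]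
        positivity
      field_simp
      ring
    · filter_upwards [hpos, hnpos] with a h1 h2
      refine (mul_le_mul_of_nonneg_left (Real.log_le_sub_one_of_pos h1) h2.le).trans
        (le_of_eq ?_)
      field_simp
      ring
  refine ((Real.continuous_exp.tendsto τ).comp hlog).congr' ?_
  filter_upwards [hpos] with a h1
  simp only [Function.comp]
  rw [← Real.log_pow, Real.exp_log (pow_pos h1 _)]

/-- The weight `n ^ (3/2) * e ^ (-n)`, which normalizes the Abel polynomials. -/
noncomputable def abelWeight (n : ℕ) : ℝ := Real.exp (-n) * (n * Real.sqrt n)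

lemma abelWeight_pos {n : ℕ} (hn : 0 < n) : 0 < abelWeight n := by
  unfold abelWeight; positivity

lemma factorial_eq_stirlingSeq (n : ℕ) (hn : n ≠ 0) : (n.factorial : ℝ) =
    Stirling.stirlingSeq n * (Real.sqrt 2 * Real.sqrt n * (n ^ n * Real.exp (-n))) := by
  have h : (n : ℝ) ≠ 0 := Nat.cast_ne_zero.2 hn
  have h2 : Real.sqrt n ≠ 0 := (Real.sqrt_pos.2 (by positivity)).ne'
  have h3 : Real.exp 1 ^ n = Real.exp n := by rw [← Real.exp_nat_mul, mul_one]
  unfold Stirling.stirlingSeq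
  rw [Real.sqrt_mul (by norm_num), div_pow, h3, Real.exp_neg]
  field_simp

lemma stirlingSeq_pos {n : ℕ} (hn : n ≠ 0) : 0 < Stirling.stirlingSeq n := by
  obtain ⟨m, rfl⟩ := Nat.exists_eq_succ_of_ne_zero hn
  exact Stirling.stirlingSeq'_pos m

lemma tendsto_abelCoeff {n : α → ℕ} (hn : Tendsto n f atTop) {t : α → ℝ} {τ : ℝ}
    (ht : Tendsto t f (𝓝 τ)) :
    Tendsto (fun a => abelCoeff (t a) (n a) * abelWeight (n a)) f
      (𝓝 (τ * Real.exp τ / Real.sqrt (2 * Real.pi))) := by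
  have hn' : Tendsto (fun a => (n a : ℝ)) f atTop := tendsto_natCast_atTop_atTop.comp hn
  have hy : Tendsto (fun a => 1 + t a / n a) f (𝓝 1) := by
    simpa using (tendsto_const_nhds (x := (1 : ℝ))).add (ht.div_atTop hn')
  have hs := Stirling.tendsto_stirlingSeq_sqrt_pi.comp hn
  have hlim : Tendsto (fun a => t a * ((1 + t a / n a) ^ n a / (1 + t a / n a)) /
      (Stirling.stirlingSeq (n a) * Real.sqrt 2)) f
      (𝓝 (τ * (Real.exp τ / 1) / (Real.sqrt Real.pi * Real.sqrt 2))) :=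
    (ht.mul ((tendsto_one_add_div_pow hn ht).div hy one_ne_zero)).div
      (hs.mul_const _) (by positivity)
  rw [div_one, mul_comm (Real.sqrt Real.pi), ← Real.sqrt_mul (by norm_num)] at hlim
  refine hlim.congr' ?_
  filter_upwards [hn.eventually_ge_atTop 1, hy.eventually_const_lt one_pos] with a h1 h2
  obtain ⟨m, hm⟩ : ∃ m, n a = m + 1 := ⟨n a - 1, by omega⟩
  have hs0 := (stirlingSeq_pos (n := n a) (by omega)).ne'
  have hnR : (0 : ℝ) < n a := by exact_mod_cast h1
  have hsq : 0 < Real.sqrt (n a) := Real.sqrt_pos.2 hnR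
  have e1 : t a + n a = n a * (1 + t a / n a) := by field_simp; ring
  unfold abelCoeff abelWeight
  rw [if_neg (by omega), factorial_eq_stirlingSeq _ (by omega), e1]
  generalize 1 + t a / n a = y at *
  have hy0 := h2.ne'
  have e2 : y ^ n a / y = y ^ (n a - 1) := by
    rw [hm, Nat.add_sub_cancel, pow_succ]; field_simp
  have e3 : (n a : ℝ) ^ n a = n a ^ (n a - 1) * n a := by
    rw [← pow_succ, Nat.sub_add_cancel h1]
  rw [e2, e3, mul_pow]
  field_simp

lemma tendsto_abelWeight_add_div (i : ℕ) :
    Tendsto (fun n : ℕ => abelWeight (n + i) / abelWeight n) atTop (𝓝 (Real.exp (-i))) := by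
  have h1 : Tendsto (fun n : ℕ => 1 + (i : ℝ) / n) atTop (𝓝 1) := by
    simpa using (tendsto_const_nhds (x := (1 : ℝ))).add (tendsto_const_div_atTop_nhds_zero_nat _)
  have h2 := (h1.mul h1.sqrt).const_mul (Real.exp (-i))
  rw [Real.sqrt_one, mul_one, mul_one] at h2
  refine h2.congr' ?_
  filter_upwards [eventually_gt_atTop 0] with n hn
  have hn' : (0 : ℝ) < n := by exact_mod_cast hn
  have hsq : 0 < Real.sqrt n := Real.sqrt_pos.2 hn'
  unfold abelWeight
  rw [show 1 + (i : ℝ) / n = (n + i) / n by field_simp, Real.sqrt_div (by positivity)]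
  push_cast
  rw [neg_add, Real.exp_add]
  field_simp

lemma betaCoeff_eq_sub (c : ℕ → ℝ) (n : ℕ) : betaCoeff c n =
    divPow 0 n - ∑ j ∈ Finset.range n, betaCoeff c j * divPow (-c (j + 1)) (n - j) := by
  have h := sum_betaCoeff_mul_divPow_neg c n
  rw [Finset.Nat.sum_antidiagonal_eq_sum_range_succ_mk, Finset.sum_range_succ] at h
  simp only [Nat.sub_self, divPow_zero, mul_one] at h
  linarith

lemma tendsto_betaCoeff {cc : α → ℕ → ℝ} {c : ℕ → ℝ}
    (hc : ∀ i, 1 ≤ i → Tendsto (fun a => cc a i) f (𝓝 (c i))) (n : ℕ) :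
    Tendsto (fun a => betaCoeff (cc a) n) f (𝓝 (betaCoeff c n)) := by
  induction n using Nat.strong_induction_on with
  | _ n ih =>
    simp only [fun c => betaCoeff_eq_sub c n]
    refine tendsto_const_nhds.sub (tendsto_finsetSum _ fun j hj => ?_)
    refine (ih j (Finset.mem_range.1 hj)).mul ?_
    unfold divPow
    exact ((hc _ (by omega)).neg.pow _).div_const _

/-- Beyond M the levels are linear, so the Abel parameter in `sum_betaCoeff_mul_abelCoeff` is 0 and
only the terms i < M and i = n survive. -/
lemma betaCoeff_eq_abelCoeff_sub {c : ℕ → ℝ} {θ : ℝ} {M : ℕ}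
    (hc : ∀ i, M < i → c i = θ + i - 1) {n : ℕ} (hn : M ≤ n) :
    betaCoeff c n = abelCoeff θ n -
      ∑ i ∈ Finset.range M, betaCoeff c i * abelCoeff (θ + i - c (i + 1)) (n - i) := by
  have h := sum_betaCoeff_mul_abelCoeff c θ n
  rw [Finset.Nat.sum_antidiagonal_eq_sum_range_succ_mk, Finset.sum_range_succ,
    ← Finset.sum_range_add_sum_Ico _ hn] at h
  have h0 : ∑ i ∈ Finset.Ico M n,
      betaCoeff c i * abelCoeff (θ + i - c (i + 1)) (n - i) = 0 := by
    refine Finset.sum_eq_zero fun i hi => ?_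
    have := Finset.mem_Ico.1 hi
    rw [hc (i + 1) (by omega), abelCoeff, if_neg (by omega)]
    push_cast
    rw [show θ + i - (θ + (i + 1) - 1) = 0 by ring]
    simp
  simp only [h0, Nat.sub_self, add_zero] at h
  rw [← h]
  simp [abelCoeff]

/-- The limit of the Gončarov coefficients, normalized by the weights `abelWeight` and `e ^ θ`. -/
noncomputable def goncarovLimit (M : ℕ) (θ : ℝ) (c : ℕ → ℝ) : ℝ :=
  θ + ∑ i ∈ Finset.range M, betaCoeff c i * (c (i + 1) - θ - i) * Real.exp (-c (i + 1))

lemma tendsto_betaCoeff_mul_abelWeight {cc : α → ℕ → ℝ} {c : ℕ → ℝ} {θ : ℝ} {M : ℕ}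
    (hc : ∀ i, 1 ≤ i → Tendsto (fun a => cc a i) f (𝓝 (c i)))
    (hM : ∀ a i, M < i → cc a i = θ + i - 1) {n : α → ℕ} (hn : Tendsto n f atTop) :
    Tendsto (fun a => betaCoeff (cc a) (n a) * abelWeight (n a)) f
      (𝓝 (Real.exp θ / Real.sqrt (2 * Real.pi) * goncarovLimit M θ c)) := by
  have hterm : ∀ i : ℕ, Tendsto (fun a => betaCoeff (cc a) i *
      (abelCoeff (θ + i - cc a (i + 1)) (n a - i) * abelWeight (n a - i)) *
        (abelWeight (n a - i + i) / abelWeight (n a - i))) f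
      (𝓝 (betaCoeff c i * ((θ + i - c (i + 1)) * Real.exp (θ + i - c (i + 1)) /
        Real.sqrt (2 * Real.pi)) * Real.exp (-i))) := fun i => by
    have hni : Tendsto (fun a => n a - i) f atTop := (tendsto_sub_atTop_nat i).comp hn
    exact ((tendsto_betaCoeff hc i).mul (tendsto_abelCoeff hni
      (tendsto_const_nhds.sub (hc (i + 1) (by omega))))).mul
      ((tendsto_abelWeight_add_div i).comp hni)
  have hlim := (tendsto_abelCoeff hn (tendsto_const_nhds (x := θ))).sub
    (tendsto_finsetSum (Finset.range M) fun i _ => hterm i)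
  have heq : Real.exp θ / Real.sqrt (2 * Real.pi) * goncarovLimit M θ c =
      θ * Real.exp θ / Real.sqrt (2 * Real.pi) - ∑ i ∈ Finset.range M,
        betaCoeff c i * ((θ + i - c (i + 1)) * Real.exp (θ + i - c (i + 1)) /
        Real.sqrt (2 * Real.pi)) * Real.exp (-i) := by
    rw [goncarovLimit, mul_add, sub_eq_add_neg, ← Finset.sum_neg_distrib, Finset.mul_sum]
    congr 1
    · ring
    · refine Finset.sum_congr rfl fun i _ => ?_
      have : Real.exp θ * Real.exp (-c (i + 1)) =
          Real.exp (θ + i - c (i + 1)) * Real.exp (-i) := by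
        rw [← Real.exp_add, ← Real.exp_add]; congr 1; ring
      linear_combination
        (betaCoeff c i * (c (i + 1) - θ - i) / Real.sqrt (2 * Real.pi)) * this
  rw [heq]
  refine hlim.congr' ?_
  filter_upwards [hn.eventually_gt_atTop M] with a ha
  rw [betaCoeff_eq_abelCoeff_sub (hM a) ha.le, sub_mul, Finset.sum_mul]
  congr 1
  refine Finset.sum_congr rfl fun i hi => ?_
  have hi' := Finset.mem_range.1 hi
  have hpos := (abelWeight_pos (n := n a - i) (by omega)).ne'
  rw [Nat.sub_add_cancel (by omega)]
  field_simp

lemma goncarovLimit_pos {c : ℕ → ℝ} {θ : ℝ} {M : ℕ} (hM : ∀ i, M < i → c i = θ + i - 1)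
    (hmono : ∀ i, 1 ≤ i → c i ≤ c (i + 1)) (h0 : 0 < c 1) : 0 < goncarovLimit M θ c := by
  have hle : ∀ i, c 1 ≤ c (i + 1) := fun i => by
    induction i with
    | zero => rfl
    | succ i hi => exact hi.trans (hmono _ (by omega))
  -- After a shift by M + 1 the levels are τ + r - 1 with τ ≥ 1; a shift by M would only give a
  -- nonnegative parameter.
  set τ := θ + (M + 1 : ℕ) - c 1 with hτ
  have hτpos : 0 < τ := by
    have h1 := hle M
    rw [hM (M + 1) (by omega)] at h1
    rw [hτ]; linarith
  have hlow : ∀ j : ℕ, 1 ≤ j →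
      divPow (c 1) (M + 1) * (abelCoeff τ j * abelWeight j) *
        (abelWeight (j + (M + 1)) / abelWeight j) ≤
      betaCoeff c (j + (M + 1)) * abelWeight (j + (M + 1)) := fun j hj => by
    have h1 := le_betaCoeff h0.le hmono (M + 1) j
    rw [betaCoeff_linear (c := fun r => c (M + 1 + r) - c 1) τ fun i hi => by
      rw [hM _ (by omega), hτ]; push_cast; ring, add_comm (M + 1) j] at h1
    have h2 := (abelWeight_pos (n := j) (by omega)).ne'
    have h3 := (abelWeight_pos (n := j + (M + 1)) (by omega))
    refine le_trans (le_of_eq ?_) (mul_le_mul_of_nonneg_right h1 h3.le)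
    field_simp
  have hl1 := ((tendsto_abelCoeff tendsto_id (tendsto_const_nhds (x := τ))).const_mul
    (divPow (c 1) (M + 1))).mul (tendsto_abelWeight_add_div (M + 1))
  have hl2 := tendsto_betaCoeff_mul_abelWeight (cc := fun _ : ℕ => c) (c := c)
    (fun i _ => tendsto_const_nhds) (fun _ => hM) (tendsto_add_atTop_nat (M + 1))
  have hfin := le_of_tendsto_of_tendsto hl1 hl2 (eventually_atTop.2 ⟨1, hlow⟩)
  have hpos : 0 < divPow (c 1) (M + 1) * (τ * Real.exp τ / Real.sqrt (2 * Real.pi)) *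
      Real.exp (-(M + 1 : ℕ)) := by
    unfold divPow; positivity
  exact pos_of_mul_pos_right (hpos.trans_le hfin) (by positivity)

end Asymptotics

/-! ### Telescoping comparison for the tail -/

section TailSum

/-- A sum of terms asymptotic to `V` times the increments of `S` is asymptotic to `V` times the
last value of `S`, if the first few terms are negligible. -/
lemma tendsto_sum_div_of_increments {u S : ℕ → ℕ → ℝ} {L : ℕ → ℕ} {V : ℝ}
    (hL : Tendsto L atTop atTop) (hNL : Tendsto (fun N => N - L N) atTop atTop)
    (hS : ∀ N m, 0 ≤ S N m) (hpos : ∀ᶠ N in atTop, 0 < S N (L N))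
    (hinc : ∀ ε > 0, ∃ J : ℕ, ∀ N m, J ≤ m → J + 1 ≤ N - m →
      |u N (m + 1) - V * (S N (m + 1) - S N m)| ≤ ε * (S N (m + 1) - S N m))
    (hSlim : ∀ m, Tendsto (fun N => S N m / S N (L N)) atTop (𝓝 0))
    (hulim : ∀ m, Tendsto (fun N => u N m / S N (L N)) atTop (𝓝 0)) :
    Tendsto (fun N => (∑ m ∈ Finset.range (L N + 1), u N m) / S N (L N)) atTop (𝓝 V) := by
  rw [Metric.tendsto_nhds]
  intro ε hε
  obtain ⟨J, hJ⟩ := hinc (ε / 2) (by positivity)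
  have hsmall : Tendsto (fun N => (∑ m ∈ Finset.range (J + 1), |u N m / S N (L N)|)
      + |V| * (S N J / S N (L N))) atTop (𝓝 0) := by
    simpa using (tendsto_finsetSum (Finset.range (J + 1)) fun m _ => (hulim m).abs).add
      ((hSlim J).const_mul |V|)
  filter_upwards [hpos, hsmall.eventually_lt_const (half_pos hε), hL.eventually_ge_atTop J,
    hNL.eventually_ge_atTop (J + 1)] with N h1 h2 h3 h4
  have hsplit : (∑ m ∈ Finset.range (L N + 1), u N m) - V * S N (L N) =
      ∑ m ∈ Finset.range (J + 1), u N m +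
      (∑ m ∈ Finset.Ico J (L N), (u N (m + 1) - V * (S N (m + 1) - S N m))) - V * S N J := by
    rw [Finset.sum_sub_distrib, ← Finset.mul_sum, Finset.sum_Ico_sub _ h3,
      ← Finset.sum_range_add_sum_Ico _ (Nat.succ_le_succ h3),
      Finset.sum_Ico_add' (fun m => u N m) J (L N) 1]
    ring
  have hmid : |∑ m ∈ Finset.Ico J (L N), (u N (m + 1) - V * (S N (m + 1) - S N m))|
      ≤ ε / 2 * S N (L N) := by
    refine (Finset.abs_sum_le_sum_abs _ _).trans ((Finset.sum_le_sum fun m hm => hJ N m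
      (Finset.mem_Ico.1 hm).1 ?_).trans ?_)
    · have := (Finset.mem_Ico.1 hm).2
      omega
    · rw [← Finset.mul_sum, Finset.sum_Ico_sub _ h3]
      exact mul_le_mul_of_nonneg_left (sub_le_self _ (hS N J)) (by positivity)
  have hfirst : |∑ m ∈ Finset.range (J + 1), u N m| ≤
      (∑ m ∈ Finset.range (J + 1), |u N m / S N (L N)|) * S N (L N) := by
    refine (Finset.abs_sum_le_sum_abs _ _).trans (le_of_eq ?_)
    rw [Finset.sum_mul]
    refine Finset.sum_congr rfl fun m _ => ?_
    rw [abs_div, abs_of_pos h1, div_mul_cancel₀ _ h1.ne']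
  have hlast : |V * S N J| = |V| * (S N J / S N (L N)) * S N (L N) := by
    rw [abs_mul, abs_of_nonneg (hS N J)]
    field_simp
  rw [Real.dist_eq, div_sub' h1.ne', mul_comm (S N (L N)) V, abs_div, abs_of_pos h1, div_lt_iff₀ h1,
    hsplit]
  calc _ ≤ |∑ m ∈ Finset.range (J + 1), u N m| +
        |∑ m ∈ Finset.Ico J (L N), (u N (m + 1) - V * (S N (m + 1) - S N m))| + |V * S N J| :=
        (abs_sub _ _).trans (add_le_add_left (abs_add_le _ _) _)
    _ ≤ ((∑ m ∈ Finset.range (J + 1), |u N m / S N (L N)|)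
      + |V| * (S N J / S N (L N))) * S N (L N) + ε / 2 * S N (L N) := by
        rw [hlast]; linarith
    _ < ε / 2 * S N (L N) + ε / 2 * S N (L N) := by gcongr
    _ = ε * S N (L N) := by ring

/-- The scale `√(m / ((N - m) N))` of the probability that at least `N - m` of `N` lines fail. -/
noncomputable def tailScale (N m : ℕ) : ℝ := Real.sqrt (m / ((N - m : ℕ) * N))

/-- The term of index `j` in the Abel–Gončarov expansion of the failure probabilities. -/
noncomputable def tailTerm (c : ℕ → ℝ) (N j : ℕ) : ℝ :=
  N.factorial / (N : ℝ) ^ N * (betaCoeff c j * divPow (N - c (j + 1)) (N - j))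

variable {α : Type*} {f : Filter α}

/-- Discrete form of ∂_m √(m/((N-m)N)) = ½ √N / (√m (N-m)^(3/2)), obtained by rationalizing a
difference of square roots. -/
lemma tendsto_tailScale_increment {j m : α → ℕ} (hj : Tendsto j f atTop)
    (hm : Tendsto m f atTop) :
    Tendsto (fun a => (tailScale (j a + (m a + 1)) (m a + 1) - tailScale (j a + (m a + 1)) (m a)) *
      (j a * Real.sqrt (j a) * Real.sqrt (m a + 1 : ℕ) / Real.sqrt (j a + (m a + 1) : ℕ))) f
      (𝓝 (1 / 2)) := by
  have h1 : ∀ {n : α → ℕ}, Tendsto n f atTop →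
      Tendsto (fun a => (n a : ℝ) / (n a + 1)) f (𝓝 1) := fun hn =>
    (tendsto_natCast_div_add_atTop (1 : ℝ)).comp hn
  have hlim := (h1 hj).div ((tendsto_const_nhds (x := (1 : ℝ))).add ((h1 hm).mul (h1 hj)).sqrt)
    (by simp)
  have hval : (1 : ℝ) / (1 + Real.sqrt (1 * 1)) = 1 / 2 := by norm_num
  rw [hval] at hlim
  refine hlim.congr' ?_
  filter_upwards [hj.eventually_gt_atTop 0] with a ha
  simp only [Pi.div_apply]
  generalize j a = j at *
  generalize m a = m at *
  have hj0 : (0 : ℝ) < j := by exact_mod_cast ha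
  have hm0 : (0 : ℝ) ≤ m := by positivity
  have e1 : j + (m + 1) - (m + 1) = j := by omega
  have e2 : j + (m + 1) - m = j + 1 := by omega
  unfold tailScale
  rw [e1, e2]
  push_cast
  set n : ℝ := j + (m + 1) with hn
  have hn0 : 0 < n := by positivity
  have hs1 : Real.sqrt (m / ((j + 1) * n)) =
      Real.sqrt ((m + 1) / (j * n)) * Real.sqrt (m / (m + 1) * (j / (j + 1))) := by
    rw [← Real.sqrt_mul (by positivity)]
    congr 1
    field_simp
  set r := Real.sqrt (m / (m + 1) * (j / (j + 1))) with hr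
  have hr0 : 0 ≤ r := Real.sqrt_nonneg _
  have hr2 : r ^ 2 = m / (m + 1) * (j / (j + 1)) := Real.sq_sqrt (by positivity)
  rw [hs1, Real.sqrt_div (by positivity), Real.sqrt_mul hj0.le]
  have q1 : 0 < Real.sqrt j := Real.sqrt_pos.2 hj0
  have q2 : 0 < Real.sqrt n := Real.sqrt_pos.2 hn0
  have q3 : Real.sqrt (m + 1) * Real.sqrt (m + 1) = m + 1 :=
    Real.mul_self_sqrt (by positivity)
  have q4 : Real.sqrt n * Real.sqrt n = n := Real.mul_self_sqrt hn0.le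
  have hfac : (Real.sqrt (m + 1) / (Real.sqrt j * Real.sqrt n) -
      Real.sqrt (m + 1) / (Real.sqrt j * Real.sqrt n) * r) *
      (j * Real.sqrt j * Real.sqrt (m + 1) / Real.sqrt n) =
      j * (Real.sqrt (m + 1) * Real.sqrt (m + 1)) / (Real.sqrt n * Real.sqrt n) * (1 - r) := by
    field_simp
  rw [hfac, q3, q4, div_eq_iff (by positivity)]
  have : (1 - r) * (1 + r) = n / ((m + 1) * (j + 1)) := by
    rw [show (1 - r) * (1 + r) = 1 - r ^ 2 by ring, hr2, hn]
    field_simp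
    ring
  rw [mul_assoc, this]
  field_simp

lemma tailTerm_eq {c : ℕ → ℝ} {θ : ℝ} {j m : ℕ} (hc : c (j + 1) = θ + j) (hj : j ≠ 0)
    (hm : m ≠ 0) : tailTerm c (j + m) j =
      Stirling.stirlingSeq (j + m) / Stirling.stirlingSeq m * (1 + (-θ) / m) ^ m *
        (betaCoeff c j * abelWeight j) *
        (Real.sqrt (j + m : ℕ) / (j * Real.sqrt j * Real.sqrt m)) := by
  have hm0 : (0 : ℝ) < m := by exact_mod_cast Nat.pos_of_ne_zero hm
  have hj0 : (0 : ℝ) < j := by exact_mod_cast Nat.pos_of_ne_zero hj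
  have hN0 : (0 : ℝ) < (j + m : ℕ) := by exact_mod_cast (by omega : 0 < j + m)
  have q1 : 0 < Real.sqrt j := Real.sqrt_pos.2 hj0
  have q2 : 0 < Real.sqrt m := Real.sqrt_pos.2 hm0
  have s1 := (stirlingSeq_pos hm).ne'
  have hexp : Real.exp (-(j + m : ℕ)) = Real.exp (-j) * Real.exp (-m) := by
    rw [← Real.exp_add]; push_cast; congr 1; ring
  have e1 : ((j + m : ℕ) : ℝ) - c (j + 1) = m * (1 + (-θ) / m) := by
    rw [hc]; push_cast; field_simp; ring
  unfold tailTerm divPow abelWeight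
  rw [Nat.add_sub_cancel_left, e1, factorial_eq_stirlingSeq (j + m) (by omega),
    factorial_eq_stirlingSeq m hm, hexp, mul_pow]
  field_simp

/-- The factor (1 - θ/m)^m tends to e^(-θ) and cancels the e^θ in the asymptotics of β_j. -/
lemma tendsto_tailTerm {cc : α → ℕ → ℝ} {c : ℕ → ℝ} {θ : ℝ} {M : ℕ}
    (hc : ∀ i, 1 ≤ i → Tendsto (fun a => cc a i) f (𝓝 (c i)))
    (hM : ∀ a i, M < i → cc a i = θ + i - 1) {j m : α → ℕ} (hj : Tendsto j f atTop)
    (hm : Tendsto m f atTop) :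
    Tendsto (fun a => tailTerm (cc a) (j a + m a) (j a) *
      (j a * Real.sqrt (j a) * Real.sqrt (m a) / Real.sqrt (j a + m a : ℕ))) f
      (𝓝 (goncarovLimit M θ c / Real.sqrt (2 * Real.pi))) := by
  have hpi : Real.sqrt Real.pi ≠ 0 := by positivity
  have hs := Stirling.tendsto_stirlingSeq_sqrt_pi
  have hlim := (((hs.comp (hj.atTop_add_nonneg fun a => Nat.zero_le (m a))).div (hs.comp hm)
    hpi).mul (tendsto_one_add_div_pow hm (tendsto_const_nhds (x := -θ)))).mul
    (tendsto_betaCoeff_mul_abelWeight hc hM hj)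
  have hval : Real.sqrt Real.pi / Real.sqrt Real.pi * Real.exp (-θ) *
      (Real.exp θ / Real.sqrt (2 * Real.pi) * goncarovLimit M θ c) =
      goncarovLimit M θ c / Real.sqrt (2 * Real.pi) := by
    rw [div_self hpi, Real.exp_neg]
    field_simp
  rw [hval] at hlim
  refine hlim.congr' ?_
  filter_upwards [hj.eventually_gt_atTop M, hm.eventually_gt_atTop 0] with a h1 h2
  have hm0 : (0 : ℝ) < m a := by exact_mod_cast h2
  have hj0 : (0 : ℝ) < j a := by exact_mod_cast (by omega : 0 < j a)
  have hN0 : (0 : ℝ) < (j a + m a : ℕ) := by exact_mod_cast (by omega : 0 < j a + m a)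
  have q1 : 0 < Real.sqrt (j a) := Real.sqrt_pos.2 hj0
  have q2 : 0 < Real.sqrt (m a) := Real.sqrt_pos.2 hm0
  have q3 : 0 < Real.sqrt (j a + m a : ℕ) := Real.sqrt_pos.2 hN0
  rw [tailTerm_eq (θ := θ) (by rw [hM _ _ (by omega)]; push_cast; ring) (by omega) (by omega)]
  simp only [Function.comp, Pi.div_apply]
  field_simp

/-- For fixed m the term is O(1/N), hence negligible against the scale at L(N), which is at least
√L(N) / N for large N. -/
lemma tendsto_tailTerm_sub_mul {cc : ℕ → ℕ → ℝ} {c : ℕ → ℝ} {θ : ℝ} {M : ℕ}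
    (hc : ∀ i, 1 ≤ i → Tendsto (fun N => cc N i) atTop (𝓝 (c i)))
    (hM : ∀ N i, M < i → cc N i = θ + i - 1) (m : ℕ) :
    ∃ a : ℝ, Tendsto (fun N => tailTerm (cc N) N (N - m) * N) atTop (𝓝 a) := by
  have hj : Tendsto (fun N => N - m) atTop atTop := tendsto_sub_atTop_nat m
  have hs := Stirling.tendsto_stirlingSeq_sqrt_pi
  have hlim := ((hs.const_mul (Real.sqrt 2 * divPow (m - θ) m)).mul
    (tendsto_betaCoeff_mul_abelWeight hc hM hj)).mul
    ((tendsto_abelWeight_add_div m).comp hj)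
  refine ⟨_, hlim.congr' ?_⟩
  filter_upwards [eventually_gt_atTop (m + M)] with N hN
  obtain ⟨j, rfl⟩ : ∃ j, N = j + m := ⟨N - m, by omega⟩
  have hN0 : (0 : ℝ) < (j + m : ℕ) := by exact_mod_cast (by omega : 0 < j + m)
  have hw := (abelWeight_pos (n := j) (by omega)).ne'
  have q3 : 0 < Real.sqrt (j + m : ℕ) := Real.sqrt_pos.2 hN0
  have q4 : Real.sqrt (j + m : ℕ) * Real.sqrt (j + m : ℕ) = (j + m : ℕ) :=
    Real.mul_self_sqrt hN0.le
  have e1 : ((j + m : ℕ) : ℝ) - cc (j + m) (j + 1) = m - θ := by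
    rw [hM _ _ (by omega)]; push_cast; ring
  simp only [Function.comp, Nat.add_sub_cancel]
  unfold tailTerm
  rw [Nat.add_sub_cancel_left, e1, factorial_eq_stirlingSeq (j + m) (by omega)]
  have hw2 : abelWeight (j + m) = Real.exp (-(j + m : ℕ)) *
    ((j + m : ℕ) * Real.sqrt (j + m : ℕ)) := rfl
  rw [hw2]
  field_simp

end TailSum

lemma tailScale_mul (N m : ℕ) :
    tailScale N m * N = Real.sqrt (m / ((N - m : ℕ) * N) * (N * N)) := by
  rw [Real.sqrt_mul (by positivity), Real.sqrt_mul_self (Nat.cast_nonneg _), tailScale]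

lemma tendsto_tailScale_mul (m : ℕ) :
    Tendsto (fun N => tailScale N m * N) atTop (𝓝 (Real.sqrt m)) := by
  have h1 : Tendsto (fun N : ℕ => (m : ℝ) * (1 + (m : ℝ) / (N - m : ℕ))) atTop (𝓝 m) := by
    simpa using ((tendsto_const_nhds (x := (1 : ℝ))).add
      ((tendsto_const_div_atTop_nhds_zero_nat (m : ℝ)).comp
        (tendsto_sub_atTop_nat m))).const_mul (m : ℝ)
  refine h1.sqrt.congr' ?_
  filter_upwards [eventually_gt_atTop m] with N hN
  obtain ⟨j, rfl⟩ : ∃ j, N = j + m := ⟨N - m, by omega⟩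
  have hj : (0 : ℝ) < j := by exact_mod_cast (by omega : 0 < j)
  rw [tailScale_mul, Nat.add_sub_cancel]
  congr 1
  have : ((j + m : ℕ) : ℝ) ≠ 0 := by exact_mod_cast (by omega : j + m ≠ 0)
  field_simp
  push_cast
  ring

lemma tendsto_tailScale_mul_atTop {L : ℕ → ℕ} (hL : Tendsto L atTop atTop)
    (hNL : Tendsto (fun N => N - L N) atTop atTop) :
    Tendsto (fun N => tailScale N (L N) * N) atTop atTop := by
  refine tendsto_atTop_mono' atTop ?_
    (Real.tendsto_sqrt_atTop.comp (tendsto_natCast_atTop_atTop.comp hL))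
  filter_upwards [hNL.eventually_gt_atTop 0] with N hN
  have hN0 : (0 : ℝ) < N := by exact_mod_cast (by omega : 0 < N)
  have hj : (0 : ℝ) < (N - L N : ℕ) := by exact_mod_cast hN
  have hle : ((N - L N : ℕ) : ℝ) ≤ N := by exact_mod_cast Nat.sub_le _ _
  simp only [Function.comp]
  rw [tailScale_mul]
  refine Real.sqrt_le_sqrt ?_
  rw [show (L N : ℝ) / ((N - L N : ℕ) * N) * (N * N) = L N * (N / (N - L N : ℕ)) by field_simp]
  exact le_mul_of_one_le_right (Nat.cast_nonneg _) ((one_le_div hj).2 hle)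

lemma tendsto_sum_tailTerm {cc : ℕ → ℕ → ℝ} {c : ℕ → ℝ} {θ : ℝ} {M : ℕ}
    (hc : ∀ i, 1 ≤ i → Tendsto (fun N => cc N i) atTop (𝓝 (c i)))
    (hM : ∀ N i, M < i → cc N i = θ + i - 1) {L : ℕ → ℕ} (hL : Tendsto L atTop atTop)
    (hNL : Tendsto (fun N => N - L N) atTop atTop) :
    Tendsto (fun N => (∑ m ∈ Finset.range (L N + 1), tailTerm (cc N) N (N - m)) /
      tailScale N (L N)) atTop (𝓝 (2 / Real.sqrt (2 * Real.pi) * goncarovLimit M θ c)) := by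
  have hinv := (tendsto_tailScale_mul_atTop hL hNL).inv_tendsto_atTop
  have hsmall : ∀ {x : ℕ → ℝ} {a : ℝ}, Tendsto (fun N => x N * N) atTop (𝓝 a) →
      Tendsto (fun N => x N / tailScale N (L N)) atTop (𝓝 0) := fun hx => by
    have h := hx.mul hinv
    rw [mul_zero] at h
    refine h.congr' ?_
    filter_upwards [eventually_gt_atTop 0] with N hN
    have hN0 : (N : ℝ) ≠ 0 := by exact_mod_cast hN.ne'
    simp only [Pi.inv_apply, mul_inv]
    field_simp
  refine tendsto_sum_div_of_increments (u := fun N m => tailTerm (cc N) N (N - m)) hL hNL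
    (fun N m => Real.sqrt_nonneg _) ?_ ?_ (fun m => hsmall (tendsto_tailScale_mul m))
    (fun m => hsmall (tendsto_tailTerm_sub_mul hc hM m).choose_spec)
  · filter_upwards [hL.eventually_gt_atTop 0, hNL.eventually_gt_atTop 0] with N h1 h2
    have : 0 < N := by omega
    exact Real.sqrt_pos.2 (by positivity)
  · intro ε hε
    set V := 2 / Real.sqrt (2 * Real.pi) * goncarovLimit M θ c with hV
    -- Limits along `atTop` on pairs (j, m) give the threshold J uniform in both variables.
    have hj : Tendsto (fun p : ℕ × ℕ => p.1) atTop atTop := by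
      rw [← prod_atTop_atTop_eq]; exact tendsto_fst
    have hm : Tendsto (fun p : ℕ × ℕ => p.2) atTop atTop := by
      rw [← prod_atTop_atTop_eq]; exact tendsto_snd
    have hm' : Tendsto (fun p : ℕ × ℕ => p.2 + 1) atTop atTop := 
      (tendsto_add_atTop_nat 1).comp hm
    have hD := tendsto_tailScale_increment hj hm
    have hu := tendsto_tailTerm (cc := fun p : ℕ × ℕ => cc (p.1 + (p.2 + 1))) (c := c)
      (fun i hi => (hc i hi).comp (hj.atTop_add_nonneg fun _ => Nat.zero_le _))
      (fun _ => hM _) hj hm'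
    have hdiff := hu.sub (hD.const_mul V)
    rw [show goncarovLimit M θ c / Real.sqrt (2 * Real.pi) - V * (1 / 2) = 0 by
      rw [hV]; ring] at hdiff
    -- The normalized increment tends to 1/2, so it eventually exceeds 1/4, and an error ε/4 is at
    -- most ε times it.
    have hev := (hdiff.abs.eventually_lt_const (u := ε / 4) (by simpa using by positivity)).and
      (hD.eventually_const_lt (u := 1 / 4) (by norm_num))
    rw [eventually_atTop_prod_self] at hev
    obtain ⟨J, hJ⟩ := hev
    refine ⟨J + 1, fun N m h1 h2 => ?_⟩
    obtain ⟨j, rfl⟩ : ∃ j, N = j + (m + 1) := ⟨N - (m + 1), by omega⟩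
    obtain ⟨h3, h4⟩ := hJ j m (by omega) (by omega)
    simp only at h3 h4
    have hj0 : 0 < j := by omega
    have hR : 0 < (j : ℝ) * Real.sqrt j * Real.sqrt (m + 1 : ℕ) /
        Real.sqrt (j + (m + 1) : ℕ) := by
      positivity
    set R := (j : ℝ) * Real.sqrt j * Real.sqrt (m + 1 : ℕ) / Real.sqrt (j + (m + 1) : ℕ)
    rw [← mul_assoc, ← sub_mul, abs_mul, abs_of_pos hR] at h3
    rw [Nat.add_sub_cancel]
    refine le_of_mul_le_mul_right (h3.le.trans ?_) hR
    calc ε / 4 = ε * (1 / 4) := by ring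
      _ ≤ _ := mul_le_mul_of_nonneg_left h4.le hε.le
      _ = _ := by ring

/-- With K = ⌈k⌉, the squared product is (N-K)/(N-k) · k/K, and rounding moves k by less than 1. -/
lemma tendsto_sqrt_mul_tailScale {k : ℕ → ℝ} (hk : Tendsto k atTop atTop)
    (hNk : Tendsto (fun N : ℕ => (N : ℝ) - k N) atTop atTop) :
    Tendsto (fun N : ℕ => Real.sqrt (k N * N / (N - k N)) * tailScale N (N - ⌈k N⌉₊)) atTop
      (𝓝 1) := by
  have h1 : Tendsto (fun N => (⌈k N⌉₊ : ℝ) / k N) atTop (𝓝 1) :=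
    (tendsto_nat_ceil_div_atTop (R := ℝ)).comp hk
  have h2 : Tendsto (fun N : ℕ => (⌈k N⌉₊ - k N) / (N - k N)) atTop (𝓝 0) := by
    refine squeeze_zero' ?_ ?_ hNk.inv_tendsto_atTop
    · filter_upwards [hNk.eventually_gt_atTop 0] with N hN
      exact div_nonneg (sub_nonneg.2 (Nat.le_ceil _)) hN.le
    · filter_upwards [hNk.eventually_gt_atTop 0, hk.eventually_gt_atTop 0] with N hN hkN
      rw [Pi.inv_apply, ← one_div]
      have := Nat.ceil_lt_add_one hkN.le
      gcongr
      linarith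
  have h3 := (((tendsto_const_nhds (x := (1 : ℝ))).sub h2).div h1 one_ne_zero).sqrt
  rw [sub_zero, div_one, Real.sqrt_one] at h3
  refine h3.congr' ?_
  filter_upwards [hNk.eventually_gt_atTop 0, hk.eventually_gt_atTop 0] with N hN hkN
  have hle : ⌈k N⌉₊ ≤ N := Nat.ceil_le.2 (by linarith)
  have hK : (0 : ℝ) < ⌈k N⌉₊ := by exact_mod_cast Nat.ceil_pos.2 hkN
  have hN0 : (0 : ℝ) < N := by linarith
  unfold tailScale
  rw [← Real.sqrt_mul (by positivity), Nat.sub_sub_self hle, Nat.cast_sub hle]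
  congr 1
  simp only [Pi.div_apply]
  field_simp
  ring

/-! ### The limit theorem -/

theorem proposition1
    -- for every `N`, a network of `N` lines with i.i.d. surplus capacities of law `ν`
    {Ω : ℕ → Type*} [∀ N, MeasurableSpace (Ω N)]
    (P : ∀ N, Measure (Ω N)) [∀ N, IsProbabilityMeasure (P N)]
    (ν : Measure ℝ) [IsProbabilityMeasure ν]
    (C : ∀ N, Fin N → Ω N → ℝ)
    (hlaw : ∀ N j, HasLaw (C N j) ν (P N))
    (hindep : ∀ N, iIndepFun (C N) (P N))
    -- the load surges, the thresholds and the perturbations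
    (l : ℕ → ℕ → ℝ) (k : ℕ → ℝ) (θ : ℝ) (Δ : ℕ → ℕ → ℝ) (Δlim : ℕ → ℝ)
    (M N₀ : ℕ) (hM : 1 ≤ M)
    (hk : Tendsto k atTop atTop)
    (hNk : Tendsto (fun N : ℕ => (N : ℝ) - k N) atTop atTop)
    (hl : ∀ N, N₀ ≤ N → MonotoneOn (l N) (Set.Icc 1 ⌈k N⌉₊))
    (hF : ∀ N, N₀ ≤ N → ∀ i, 1 ≤ i → i ≤ ⌈k N⌉₊ →
      cdf ν (l N i) = (θ + i - 1 + Δ i N) / N)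
    (hΔlim : ∀ i, 1 ≤ i → Tendsto (fun N => Δ i N) atTop (𝓝 (Δlim i)))
    (hΔ : ∀ N, N₀ ≤ N → ∀ i, M ≤ i → i ≤ ⌈k N⌉₊ → Δ i N = 0) :
    Tendsto
        (fun N : ℕ => Real.sqrt (k N * N / (N - k N)) *
          (P N).real {ω | k N ≤ (failedLines (l N) (fun j => C N j ω) : ℝ)})
        atTop (𝓝 (truncConst M θ Δlim)) ∧
      (0 < level θ Δlim 1 → 0 < truncConst M θ Δlim) := by
  have hK : Tendsto (fun N => ⌈k N⌉₊) atTop atTop := tendsto_nat_ceil_atTop.comp hk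
  have hΔ0 : ∀ i, M ≤ i → Δlim i = 0 := fun i hi => by
    refine tendsto_nhds_unique (hΔlim i (hM.trans hi)) (tendsto_const_nhds.congr' ?_)
    filter_upwards [eventually_ge_atTop N₀, hK.eventually_ge_atTop i] with N h1 h2
    exact (hΔ N h1 i hi h2).symm
  have hconst : truncConst M θ Δlim =
      2 / Real.sqrt (2 * Real.pi) * goncarovLimit M θ (level θ Δlim) := by
    rw [truncConst_eq hM θ (hΔ0 M le_rfl), goncarovLimit]
    congr 2
    refine Finset.sum_congr rfl fun i _ => ?_
    rw [show level θ Δlim (i + 1) - θ - i = Δlim (i + 1) by simp only [level]; push_cast; ring]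
  -- The levels up to ⌈k N⌉ are kept for N ≥ N₀ and continued linearly, as the exact formula allows.
  set cc : ℕ → ℕ → ℝ := fun N => level θ fun i => if i < M then Δ i N else 0 with hcc
  have hccM : ∀ N i, M < i → cc N i = θ + i - 1 := fun N i hi => by
    simp [hcc, level, not_lt.2 hi.le]
  have hcclim : ∀ i, 1 ≤ i → Tendsto (fun N => cc N i) atTop (𝓝 (level θ Δlim i)) := by
    intro i hi
    refine tendsto_const_nhds.add ?_
    by_cases h : i < M
    · simpa [h] using hΔlim i hi
    · simp [h, hΔ0 i (not_lt.1 h)]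
  have hcdf : ∀ N, N₀ ≤ N → ∀ i, 1 ≤ i → i ≤ ⌈k N⌉₊ → cdf ν (l N i) = cc N i / N := by
    intro N hN i hi hiK
    rw [hF N hN i hi hiK]
    simp only [hcc, level]
    split_ifs with h
    · rfl
    · rw [hΔ N hN i (not_lt.1 h) hiK]
  rw [hconst]
  refine ⟨?_, fun hpos => mul_pos (by positivity) (goncarovLimit_pos (fun i hi => ?_)
    (fun i hi => ?_) hpos)⟩
  · have hle : ∀ᶠ N in atTop, ⌈k N⌉₊ ≤ N := by
      filter_upwards [hNk.eventually_ge_atTop 0] with N hN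
      exact Nat.ceil_le.2 (by linarith)
    have hL : Tendsto (fun N => N - ⌈k N⌉₊) atTop atTop := by
      refine tendsto_atTop.2 fun b => ?_
      filter_upwards [hNk.eventually_ge_atTop (b + 1), hk.eventually_ge_atTop 0] with N h1 h2
      have h3 := Nat.ceil_lt_add_one h2
      have h4 : b + ⌈k N⌉₊ < N + 1 := by
        exact_mod_cast (by linarith : (b : ℝ) + ⌈k N⌉₊ < N + 1)
      omega
    have hNL : Tendsto (fun N => N - (N - ⌈k N⌉₊)) atTop atTop := by
      refine hK.congr' ?_
      filter_upwards [hle] with N hN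
      exact (Nat.sub_sub_self hN).symm
    have hlim := (tendsto_sqrt_mul_tailScale hk hNk).mul
      (tendsto_sum_tailTerm hcclim hccM hL hNL)
    rw [one_mul] at hlim
    refine hlim.congr' ?_
    filter_upwards [hle, hL.eventually_gt_atTop 0, hK.eventually_gt_atTop 0,
      eventually_ge_atTop N₀] with N h1 h2 h3 h4
    have hev : {ω | k N ≤ (failedLines (l N) (fun j => C N j ω) : ℝ)}
        = {ω | ⌈k N⌉₊ ≤ failedLines (l N) fun j => C N j ω} := by
      ext ω
      exact (Nat.ceil_le (a := k N)).symm
    have hS : 0 < tailScale N (N - ⌈k N⌉₊) := by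
      have : 0 < N := by omega
      have : 0 < N - (N - ⌈k N⌉₊) := by omega
      exact Real.sqrt_pos.2 (by positivity)
    rw [hev, measureReal_le_failedLines (hlaw N) (hindep N) (by omega) h1 (hl N h4)
      (hcdf N h4), Finset.mul_sum, mul_assoc, mul_div_cancel₀ _ hS.ne', Finset.range_eq_Ico,
      -- The substitution m = N - j turns the tail j ≥ ⌈k N⌉ into m ≤ N - ⌈k N⌉.
      Finset.sum_Ico_reflect (fun j => tailTerm (cc N) N j) 0 (by omega),
      show N + 1 - (N - ⌈k N⌉₊ + 1) = ⌈k N⌉₊ by omega]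
    rfl
  · simp [level, hΔ0 i hi.le]
  -- Monotonicity of the limiting levels is inherited from that of the load surge and of the
  -- distribution function.
  · refine le_of_tendsto_of_tendsto (hcclim i hi) (hcclim (i + 1) (by omega)) ?_
    filter_upwards [hK.eventually_ge_atTop (i + 1), eventually_ge_atTop N₀,
      eventually_gt_atTop 0] with N h1 h2 h3
    have h4 := monotone_cdf ν (hl N h2 (⟨hi, by omega⟩ : i ∈ Set.Icc 1 ⌈k N⌉₊)
      (⟨by omega, h1⟩ : i + 1 ∈ Set.Icc 1 ⌈k N⌉₊) (Nat.le_succ i))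
    rw [hcdf N h2 i hi (by omega), hcdf N h2 (i + 1) (by omega) h1] at h4
    exact (div_le_div_iff_of_pos_right (by exact_mod_cast h3)).1 h4
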